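/- Let $d\ge 3$ be an integer, $B_1=\{x\in\mathbb R^d:|x|<1\}$, and let $1<p<\infty$, $s\in[1,\infty]$ and $t\in(\frac1{p-1},\infty]$ (with $\frac1\infty=0$). Assume that either (i) $p>1+\frac1{d-2}$, $\ \frac1s+\frac1t\ge\frac p{d-1}\ $ and $\ \frac{p}{1+1/t}<d-1$, or (ii) $p\le 1+\frac1{d-2}$, $\ \frac1s+\frac1t>\frac p{d-1}\ $ and $\ \frac{p}{1+1/t}<d-1$. Then there exist a function $\lambda:B_1\to(0,\infty)$ with $\lambda\in L^s(B_1)$ and $\lambda^{-1}\in L^t(B_1)$, and a weak subsolution $v$ of $$-\nabla\cdot(\lambda|\nabla v|^{p-2}\nabla v)=0\quad\text{in }B_1$$ that is unbounded in the interior: $v$ is not locally bounded from above in $B_1$, i.e. there is a compact $K\subset B_1$ with $\operatorname{ess\,sup}_K v=+\infty$. Here $H^{1,p}(B_1,\lambda)$ and $H^{1,p}_0(B_1,\lambda)$ denote the completions, with respect to the norm $\left(\int_{B_1}\lambda|\nabla u|^p+\lambda|u|^p\,dx\right)^{1/p}$, of the set of $u\in C^1(B_1)$ of finite norm and of $C^1_c(B_1)$,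 respectively (their elements are functions with a weak gradient, because $\lambda^{-1}\in L^{1/(p-1)}(B_1)$), and $v$ is a weak subsolution if $v\in H^{1,p}(B_1,\lambda)$ and $\int_{B_1}\lambda|\nabla v|^{p-2}\nabla v\cdot\nabla\varphi\,dx\le0$ for every $\varphi\in H_0^{1,p}(B_1,\lambda)$ with $\varphi\ge0$. -/

import Mathlib

open MeasureTheory Filter Topology
open scoped ENNReal RealInnerProductSpace

noncomputable section

namespace DegenerateElliptic

/-- The lower ellipticity function of a vector field `a` (with growth exponent `p`):
`λ(x) = inf_{ξ ≠ 0} (a(x,ξ) · ξ) / |ξ|^p`. -/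
def lowerEllipticity {d : ℕ}
    (a : EuclideanSpace ℝ (Fin d) → EuclideanSpace ℝ (Fin d) → EuclideanSpace ℝ (Fin d))
    (p : ℝ) (x : EuclideanSpace ℝ (Fin d)) : ℝ≥0∞ :=
  ⨅ ξ : EuclideanSpace ℝ (Fin d), ⨅ _ : ξ ≠ 0,
    ENNReal.ofReal (inner ℝ (a x ξ) ξ) / ‖ξ‖ₑ ^ p

/-- The upper ellipticity function of a vector field `a` (with growth exponent `p`):
`μ(x) = sup_{ξ ≠ 0} |a(x,ξ)|^p / (a(x,ξ) · ξ)^(p-1)`. -/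
def upperEllipticity {d : ℕ}
    (a : EuclideanSpace ℝ (Fin d) → EuclideanSpace ℝ (Fin d) → EuclideanSpace ℝ (Fin d))
    (p : ℝ) (x : EuclideanSpace ℝ (Fin d)) : ℝ≥0∞ :=
  ⨆ ξ : EuclideanSpace ℝ (Fin d), ⨆ _ : ξ ≠ 0,
    ‖a x ξ‖ₑ ^ p / ENNReal.ofReal (inner ℝ (a x ξ) ξ) ^ (p - 1)

/-- The energy norm `(∫_Ω λ |G|^p + μ |u|^p dx)^(1/p)` of a function `u` with gradient `G`, where
`λ` and `μ` are the ellipticity functions of `a`. -/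
def energyNorm {d : ℕ} (Ω : Set (EuclideanSpace ℝ (Fin d)))
    (a : EuclideanSpace ℝ (Fin d) → EuclideanSpace ℝ (Fin d) → EuclideanSpace ℝ (Fin d)) (p : ℝ)
    (u : EuclideanSpace ℝ (Fin d) → ℝ)
    (G : EuclideanSpace ℝ (Fin d) → EuclideanSpace ℝ (Fin d)) : ℝ≥0∞ :=
  (∫⁻ x in Ω, (lowerEllipticity a p x * ‖G x‖ₑ ^ p + upperEllipticity a p x * ‖u x‖ₑ ^ p))
    ^ (1 / p)

/-- `(u, G)` represents an element of the completion, with respect to the energy norm, of the space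
of those functions in the class `C` (functions that are `C¹` in `Ω`) which have finite energy norm:
`u` and `G` are the limits, in the energy norm, of a sequence `f n` in this space and of its
gradients. The field `G` is the (weak) gradient of `u`; it is determined by `u` up to null sets as
soon as `λ⁻¹ ∈ L^{1/(p-1)}(Ω)`. -/
def MemCompletion {d : ℕ} (C : Set (EuclideanSpace ℝ (Fin d) → ℝ))
    (Ω : Set (EuclideanSpace ℝ (Fin d)))
    (a : EuclideanSpace ℝ (Fin d) → EuclideanSpace ℝ (Fin d) → EuclideanSpace ℝ (Fin d)) (p : ℝ)
    (u : EuclideanSpace ℝ (Fin d) → ℝ)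
    (G : EuclideanSpace ℝ (Fin d) → EuclideanSpace ℝ (Fin d)) : Prop :=
  AEStronglyMeasurable u (volume.restrict Ω) ∧
  AEStronglyMeasurable G (volume.restrict Ω) ∧
  ∃ f : ℕ → EuclideanSpace ℝ (Fin d) → ℝ,
    (∀ n, f n ∈ C ∧ energyNorm Ω a p (f n) (gradient (f n)) < ∞) ∧
    Tendsto (fun n => energyNorm Ω a p (fun x => f n x - u x) (fun x => gradient (f n) x - G x))
      atTop (𝓝 0)

/-- `u ∈ H^{1,p}(Ω, a)` with gradient `G`: the completion of `C¹(Ω)`. -/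
def MemH {d : ℕ} (Ω : Set (EuclideanSpace ℝ (Fin d)))
    (a : EuclideanSpace ℝ (Fin d) → EuclideanSpace ℝ (Fin d) → EuclideanSpace ℝ (Fin d)) (p : ℝ)
    (u : EuclideanSpace ℝ (Fin d) → ℝ)
    (G : EuclideanSpace ℝ (Fin d) → EuclideanSpace ℝ (Fin d)) : Prop :=
  MemCompletion {f | ContDiffOn ℝ 1 f Ω} Ω a p u G

/-- `u ∈ H₀^{1,p}(Ω, a)` with gradient `G`: the completion of `C¹_c(Ω)`. -/
def MemH₀ {d : ℕ} (Ω : Set (EuclideanSpace ℝ (Fin d)))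
    (a : EuclideanSpace ℝ (Fin d) → EuclideanSpace ℝ (Fin d) → EuclideanSpace ℝ (Fin d)) (p : ℝ)
    (u : EuclideanSpace ℝ (Fin d) → ℝ)
    (G : EuclideanSpace ℝ (Fin d) → EuclideanSpace ℝ (Fin d)) : Prop :=
  MemCompletion {f | ContDiff ℝ 1 f ∧ HasCompactSupport f ∧ tsupport f ⊆ Ω} Ω a p u G

/-- `u` is a weak subsolution of `∇ · a(x, ∇u) = 0` in `Ω`: it belongs to `H^{1,p}(Ω, a)`, with
gradient `G`, and `∫_Ω a(x, ∇u) · ∇φ dx ≤ 0` (a convergent integral) for all nonnegative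
`φ ∈ H₀^{1,p}(Ω, a)`, where `Φ = ∇φ`. -/
def IsWeakSubsolution {d : ℕ} (Ω : Set (EuclideanSpace ℝ (Fin d)))
    (a : EuclideanSpace ℝ (Fin d) → EuclideanSpace ℝ (Fin d) → EuclideanSpace ℝ (Fin d)) (p : ℝ)
    (u : EuclideanSpace ℝ (Fin d) → ℝ) : Prop :=
  ∃ G : EuclideanSpace ℝ (Fin d) → EuclideanSpace ℝ (Fin d), MemH Ω a p u G ∧
    ∀ (φ : EuclideanSpace ℝ (Fin d) → ℝ)
      (Φ : EuclideanSpace ℝ (Fin d) → EuclideanSpace ℝ (Fin d)),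
      MemH₀ Ω a p φ Φ → (∀ᵐ x ∂(volume.restrict Ω), 0 ≤ φ x) →
        IntegrableOn (fun x => inner ℝ (a x (G x)) (Φ x)) Ω ∧
        ∫ x in Ω, inner ℝ (a x (G x)) (Φ x) ≤ 0

/-- The weighted `p`-Laplace field `a(x, ξ) = w(x) |ξ|^(p-2) ξ` (which is `0` for `ξ = 0`). -/
def pLaplaceField {d : ℕ} (w : EuclideanSpace ℝ (Fin d) → ℝ) (p : ℝ)
    (x ξ : EuclideanSpace ℝ (Fin d)) : EuclideanSpace ℝ (Fin d) :=
  (w x * ‖ξ‖ ^ (p - 2)) • ξ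

/-- `u` is locally (essentially) bounded from above in `Ω`. -/
def LocallyBoundedAbove {d : ℕ} (Ω : Set (EuclideanSpace ℝ (Fin d)))
    (u : EuclideanSpace ℝ (Fin d) → ℝ) : Prop :=
  ∀ K : Set (EuclideanSpace ℝ (Fin d)), IsCompact K → K ⊆ Ω →
    ∃ M : ℝ, ∀ᵐ x ∂(volume.restrict K), u x ≤ M

end DegenerateElliptic

end

/-!
Write `x = (z, x')` with `z` the coordinate along an axis, `n = d - 1`, and `r = |x'|`. The
subsolution is `v = e ^ (c z) φ(r)` with `φ` comparable to `log (1 / r)`, so that `v` blows up along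
the whole axis, and the weight depends only on `r`. The exponential growth in `z` makes the flux
along the axis have positive divergence, and this compensates the negative divergence of the radial
flux, which is forced by the blow-up of `φ`.

The mechanism is an alternation of logarithmic shells, implemented by the two staircases
`stair τ` and `stair (τ + 1 / 2)` in the variable `τ = log (1 / r)`, which climb on disjoint sets
(`stairDeriv_add_half`). Where `φ` is almost flat the weight is large, comparable to
`r ^ (M - n)` up to logarithms, and the divergence along the axis feeds the radial flux. Where `φ`
increases, the radial flux is conserved and the weight is small, comparable to `r ^ (M - n + p)`.
Hence the weight lies in `L^s` and its inverse in `L^t` as soon as `n - M < n / s` and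
`M - n + p < n / t`; such an `M` exists when `1 / s + 1 / t > p / n`. In the case of equality both
exponents are critical and the flux carries a factor `log (1 / r) ^ b`; the two logarithmic
conditions `1 / s < p - 1 - b` and `1 / t < b` are compatible exactly when `p / n < p - 1`, that is
`p > 1 + 1 / (d - 2)`.

All functions of `r` are written as functions of `R = r²`. The properties of the radial functions
that make `v` a subsolution are collected in `Profile`; given such data, the weak formulation is
verified for smooth test functions by integrating by parts (`Profile.integral_flux`), where cutoffs
show that no mass concentrates on the axis, and both sides of the resulting identity are continuous
on `H₀` (`Profile.subsolution_inequality`). Truncations of `φ`, which are constant near the axis,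
show that `v` lies in the energy space (`Profile.memH`). The function `logφ` and the flux `powF`
provide the profile, and `exists_profile_weight_le` contains the size estimates of the weight.
-/

noncomputable section

namespace DegenerateElliptic

/-! ### The distance to the axis and integrability of singular radial weights -/

/-- The squared distance of a point of `ℝ^(n+1)` to the axis spanned by the zeroth basis vector. -/
def axisSq {n : ℕ} (x : EuclideanSpace ℝ (Fin (n + 1))) : ℝ := ∑ i : Fin n, x i.succ ^ 2

/-- The logarithmic scale `2 + log (1 / r)`, as a function of `R = r ^ 2`. -/
def logScale (R : ℝ) : ℝ := 2 - Real.log R / 2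

variable {n : ℕ}

lemma axisSq_nonneg (x : EuclideanSpace ℝ (Fin (n + 1))) : 0 ≤ axisSq x :=
  Finset.sum_nonneg fun _ _ => sq_nonneg _

@[fun_prop]
lemma continuous_axisSq : Continuous (axisSq (n := n)) := by
  unfold axisSq; fun_prop

@[fun_prop]
lemma measurable_axisSq : Measurable (axisSq (n := n)) := continuous_axisSq.measurable

@[fun_prop]
lemma contDiff_axisSq {m : WithTop ℕ∞} : ContDiff ℝ m (axisSq (n := n)) := by
  unfold axisSq; fun_prop

lemma norm_sq_eq_add_axisSq (x : EuclideanSpace ℝ (Fin (n + 1))) :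
    ‖x‖ ^ 2 = x 0 ^ 2 + axisSq x := by
  rw [EuclideanSpace.norm_sq_eq, Fin.sum_univ_succ]
  simp [axisSq]

lemma axisSq_lt_one {x : EuclideanSpace ℝ (Fin (n + 1))} (hx : x ∈ Metric.ball 0 1) :
    axisSq x < 1 := by
  have h := norm_sq_eq_add_axisSq x
  have h1 : ‖x‖ < 1 := by simpa using hx
  nlinarith [norm_nonneg x, sq_nonneg (x 0)]

lemma abs_zero_lt_one {x : EuclideanSpace ℝ (Fin (n + 1))} (hx : x ∈ Metric.ball 0 1) :
    |x 0| < 1 := by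
  have h := norm_sq_eq_add_axisSq x
  have h1 : ‖x‖ < 1 := by simpa using hx
  have := axisSq_nonneg x
  rw [← sq_lt_one_iff_abs_lt_one]
  nlinarith [norm_nonneg x]

lemma sq_le_axisSq (x : EuclideanSpace ℝ (Fin (n + 1))) (i : Fin n) :
    x i.succ ^ 2 ≤ axisSq x :=
  Finset.single_le_sum (f := fun i : Fin n => x i.succ ^ 2) (fun _ _ => sq_nonneg _)
    (Finset.mem_univ i)

lemma volume_tube_le (n : ℕ) {ρ : ℝ} (hρ : 0 ≤ ρ) :
    volume {x : EuclideanSpace ℝ (Fin (n + 1)) | x ∈ Metric.ball 0 1 ∧ axisSq x ≤ ρ ^ 2} ≤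
      ENNReal.ofReal (2 * (2 * ρ) ^ n) := by
  set b : Fin (n + 1) → ℝ := Fin.cons 1 (fun _ => ρ)
  have hsub : {x : EuclideanSpace ℝ (Fin (n + 1)) | x ∈ Metric.ball 0 1 ∧ axisSq x ≤ ρ ^ 2} ⊆
      (WithLp.ofLp (p := 2)) ⁻¹' (Set.Icc (-b) b) := by
    rintro x ⟨hx, hr⟩
    have h0 := (abs_zero_lt_one hx).le
    simp only [Set.mem_preimage, Set.mem_Icc, Pi.le_def]
    have key : ∀ i, |x i| ≤ b i := by
      intro i
      refine Fin.cases ?_ ?_ i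
      · simpa [b] using h0
      · intro i
        have := (sq_le_axisSq x i).trans hr
        simpa [b] using abs_le_of_sq_le_sq this hρ
    exact ⟨fun i => (abs_le.1 (key i)).1, fun i => (abs_le.1 (key i)).2⟩
  refine (measure_mono hsub).trans ?_
  rw [(PiLp.volume_preserving_ofLp (Fin (n + 1))).measure_preimage
    measurableSet_Icc.nullMeasurableSet, Real.volume_Icc_pi, Fin.prod_univ_succ]
  simp only [b, Pi.neg_apply, Fin.cons_zero, Fin.cons_succ, Finset.prod_const, Finset.card_univ,
    Fintype.card_fin]
  rw [ENNReal.ofReal_mul (by norm_num), ENNReal.ofReal_pow (by positivity)]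
  apply le_of_eq
  congr 3 <;> ring

lemma volume_axis (hn : n ≠ 0) :
    volume {x : EuclideanSpace ℝ (Fin (n + 1)) | x ∈ Metric.ball 0 1 ∧ axisSq x = 0} = 0 := by
  have := volume_tube_le n (le_refl (0 : ℝ))
  simp only [ne_eq, OfNat.ofNat_ne_zero, not_false_eq_true, zero_pow, mul_zero, hn,
    ENNReal.ofReal_zero, nonpos_iff_eq_zero] at this
  refine measure_mono_null ?_ this
  rintro x ⟨h1, h2⟩
  exact ⟨h1, h2.le⟩

lemma ae_axisSq_pos (hn : n ≠ 0) :
    ∀ᵐ x ∂(volume.restrict (Metric.ball (0 : EuclideanSpace ℝ (Fin (n + 1))) 1)),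
      x ∈ Metric.ball (0 : EuclideanSpace ℝ (Fin (n + 1))) 1 ∧ 0 < axisSq x := by
  rw [ae_restrict_iff' measurableSet_ball, ae_iff]
  refine measure_mono_null ?_ (volume_axis hn)
  intro x hx
  simp only [Set.mem_ofPred_eq] at hx ⊢
  push Not at hx
  exact ⟨hx.1, le_antisymm (hx.2 hx.1) (axisSq_nonneg x)⟩

lemma two_le_logScale {R : ℝ} (h0 : 0 ≤ R) (h : R ≤ 1) : 2 ≤ logScale R := by
  have := Real.log_nonpos h0 h
  unfold logScale; linarith

/-- The borderline weight `r ^ (-n) (2 + log (1 / r)) ^ (-q)`, `q > 1`, is integrable: the dyadic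
shell `e ^ (-k - 1) < r ≤ e ^ (-k)` contributes a multiple of `(2 + k) ^ (-q)`. -/
lemma lintegral_critical_lt_top (n : ℕ) {q : ℝ} (hq : 1 < q) :
    ∫⁻ x in Metric.ball (0 : EuclideanSpace ℝ (Fin (n + 1))) 1,
      ENNReal.ofReal (axisSq x ^ (-(n : ℝ) / 2) * logScale (axisSq x) ^ (-q)) < ∞ := by
  set S : ℕ → Set (EuclideanSpace ℝ (Fin (n + 1))) := fun k =>
    {x | x ∈ Metric.ball 0 1 ∧ ⌊-(Real.log (axisSq x) / 2)⌋₊ = k}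
  have hcov : Metric.ball (0 : EuclideanSpace ℝ (Fin (n + 1))) 1 ⊆ ⋃ k, S k := by
    intro x hx
    exact Set.mem_iUnion.2 ⟨_, hx, rfl⟩
  have hterm : ∀ k : ℕ, ∫⁻ x in S k,
      ENNReal.ofReal (axisSq x ^ (-(n : ℝ) / 2) * logScale (axisSq x) ^ (-q)) ≤
      ENNReal.ofReal (2 * 2 ^ n * Real.exp n * ((k + 2 : ℕ) : ℝ) ^ (-q)) := by
    intro k
    have hbd : ∀ x ∈ S k, ENNReal.ofReal
        (axisSq x ^ (-(n : ℝ) / 2) * logScale (axisSq x) ^ (-q)) ≤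
        ENNReal.ofReal (Real.exp (n * (k + 1)) * ((k + 2 : ℕ) : ℝ) ^ (-q)) := by
      rintro x ⟨hx, hk⟩
      apply ENNReal.ofReal_le_ofReal
      have hR0 := axisSq_nonneg x
      have hR1 := (axisSq_lt_one hx).le
      have hlog := Real.log_nonpos hR0 hR1
      have hk1 : (k : ℝ) ≤ -(Real.log (axisSq x) / 2) := by
        rw [← hk]; exact Nat.floor_le (by linarith)
      have hk2 : -(Real.log (axisSq x) / 2) < k + 1 := by
        rw [← hk]; exact Nat.lt_floor_add_one _
      have h2 : logScale (axisSq x) ^ (-q) ≤ ((k + 2 : ℕ) : ℝ) ^ (-q) := by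
        apply Real.rpow_le_rpow_of_nonpos (by positivity) _ (by linarith)
        unfold logScale; push_cast; linarith
      have h1 : axisSq x ^ (-(n : ℝ) / 2) ≤ Real.exp (n * (k + 1)) := by
        rcases hR0.eq_or_lt with h | h
        · rw [← h]
          refine (Real.zero_rpow_le_one _).trans (Real.one_le_exp (by positivity))
        · rw [Real.rpow_def_of_pos h]
          apply Real.exp_le_exp.2
          have : (0 : ℝ) ≤ n := by positivity
          nlinarith
      exact mul_le_mul h1 h2 (Real.rpow_nonneg (by linarith [two_le_logScale hR0 hR1]) _)
        (Real.exp_nonneg _)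
    have hvol : volume (S k) ≤ ENNReal.ofReal (2 * (2 * Real.exp (-k)) ^ n) := by
      refine (measure_mono ?_).trans (volume_tube_le n (Real.exp_nonneg (-k)))
      rintro x ⟨hx, hk⟩
      refine ⟨hx, ?_⟩
      have hR0 := axisSq_nonneg x
      have hR1 := (axisSq_lt_one hx).le
      have hlog := Real.log_nonpos hR0 hR1
      have hk1 : (k : ℝ) ≤ -(Real.log (axisSq x) / 2) := by
        rw [← hk]; exact Nat.floor_le (by linarith)
      rcases hR0.eq_or_lt with h | h
      · rw [← h]; positivity
      · rw [← Real.exp_nat_mul, ← Real.log_le_iff_le_exp h]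
        push_cast; linarith
    calc _ ≤ ∫⁻ _ in S k, ENNReal.ofReal (Real.exp (n * (k + 1)) * ((k + 2 : ℕ) : ℝ) ^ (-q)) :=
          setLIntegral_mono measurable_const hbd
      _ = ENNReal.ofReal (Real.exp (n * (k + 1)) * ((k + 2 : ℕ) : ℝ) ^ (-q)) * volume (S k) := by
          simp
      _ ≤ ENNReal.ofReal (Real.exp (n * (k + 1)) * ((k + 2 : ℕ) : ℝ) ^ (-q)) *
          ENNReal.ofReal (2 * (2 * Real.exp (-k)) ^ n) := by gcongr
      _ = _ := by
          rw [← ENNReal.ofReal_mul (by positivity)]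
          congr 1
          rw [mul_pow, ← Real.exp_nat_mul, show (n : ℝ) * (k + 1) = n + n * k by ring, Real.exp_add,
            show (n : ℝ) * -k = -(n * k) by ring, Real.exp_neg]
          field_simp
  have hsum : Summable fun k : ℕ => 2 * 2 ^ n * Real.exp n * ((k + 2 : ℕ) : ℝ) ^ (-q) := by
    apply Summable.mul_left
    exact (summable_nat_add_iff 2).2 (Real.summable_nat_rpow.2 (by linarith))
  calc _ ≤ ∫⁻ x in ⋃ k, S k,
      ENNReal.ofReal (axisSq x ^ (-(n : ℝ) / 2) * logScale (axisSq x) ^ (-q)) :=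
        lintegral_mono_set hcov
    _ ≤ ∑' k, ∫⁻ x in S k,
      ENNReal.ofReal (axisSq x ^ (-(n : ℝ) / 2) * logScale (axisSq x) ^ (-q)) :=
        lintegral_iUnion_le _ _
    _ ≤ ∑' k : ℕ, ENNReal.ofReal (2 * 2 ^ n * Real.exp n * ((k + 2 : ℕ) : ℝ) ^ (-q)) :=
        ENNReal.tsum_le_tsum hterm
    _ = ENNReal.ofReal (∑' k : ℕ, 2 * 2 ^ n * Real.exp n * ((k + 2 : ℕ) : ℝ) ^ (-q)) :=
        (ENNReal.ofReal_tsum_of_nonneg (fun k => by positivity) hsum).symm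
    _ < ∞ := ENNReal.ofReal_lt_top

/-- Powers beat logarithms. -/
lemma exists_rpow_mul_logScale_le {a : ℝ} (ha : 0 < a) (b : ℝ) :
    ∃ C, 0 ≤ C ∧ ∀ R, 0 < R → R ≤ 1 → R ^ a * logScale R ^ b ≤ C := by
  have hlim : Tendsto (fun y : ℝ => y ^ b * Real.exp (-(2 * a) * y)) atTop (𝓝 0) :=
    tendsto_rpow_mul_exp_neg_mul_atTop_nhds_zero b (2 * a) (by linarith)
  have hcont : ContinuousOn (fun y : ℝ => y ^ b * Real.exp (-(2 * a) * y)) (Set.Ici 2) := by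
    intro y hy
    have : (2 : ℝ) ≤ y := hy
    exact ((Real.continuousAt_rpow_const _ _ (Or.inl (by linarith))).mul
      (by fun_prop)).continuousWithinAt
  obtain ⟨N, hN⟩ := eventually_atTop.1 (hlim.eventually (gt_mem_nhds one_pos))
  obtain ⟨C, hC⟩ := (isCompact_Icc (a := (2 : ℝ)) (b := N)).exists_bound_of_continuousOn
    (hcont.mono Set.Icc_subset_Ici_self)
  refine ⟨max C 1 * Real.exp (4 * a), by positivity, fun R h0 h1 => ?_⟩
  have hl := two_le_logScale h0.le h1
  have hR : R ^ a = Real.exp (-(2 * a) * logScale R) * Real.exp (4 * a) := by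
    rw [Real.rpow_def_of_pos h0, ← Real.exp_add]
    unfold logScale; ring_nf
  rw [hR, mul_right_comm, mul_comm (Real.exp (-(2 * a) * logScale R))]
  apply mul_le_mul_of_nonneg_right _ (Real.exp_nonneg _)
  rcases le_total (logScale R) N with h | h
  · exact (le_abs_self _).trans ((hC _ ⟨hl, h⟩).trans (le_max_left _ _))
  · exact (hN _ h).le.trans (le_max_right _ _)

/-- A function on the unit ball bounded by `r ^ (-α) (2 + log (1 / r)) ^ (-β)` belongs to `L^s` when
`α < n / s`, or when `α = n / s` and `β > 1 / s`. -/
lemma memLp_of_le_critical (hn : n ≠ 0) {u : EuclideanSpace ℝ (Fin (n + 1)) → ℝ} {s : ℝ≥0∞}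
    (hs : s ≠ 0) {α β C : ℝ}
    (hu : AEStronglyMeasurable u
      (volume.restrict (Metric.ball (0 : EuclideanSpace ℝ (Fin (n + 1))) 1)))
    (hle : ∀ x ∈ Metric.ball (0 : EuclideanSpace ℝ (Fin (n + 1))) 1, 0 < axisSq x →
      |u x| ≤ C * (axisSq x ^ (-α / 2) * logScale (axisSq x) ^ (-β)))
    (h : α < n * (1 / s).toReal ∨ α = n * (1 / s).toReal ∧ (1 / s).toReal < β) :
    MemLp u s (volume.restrict (Metric.ball (0 : EuclideanSpace ℝ (Fin (n + 1))) 1)) := by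
  have hfin : IsFiniteMeasure
      (volume.restrict (Metric.ball (0 : EuclideanSpace ℝ (Fin (n + 1))) 1)) :=
    ⟨by simpa using measure_ball_lt_top⟩
  rcases eq_or_ne s ∞ with rfl | hst
  · -- the weight is bounded
    simp only [ENNReal.div_top, ENNReal.toReal_zero, mul_zero] at h
    obtain ⟨K, hK0, hK⟩ : ∃ K, 0 ≤ K ∧ ∀ R, 0 < R → R ≤ 1 →
        R ^ (-α / 2) * logScale R ^ (-β) ≤ K := by
      rcases h with h | ⟨rfl, h⟩
      · exact exists_rpow_mul_logScale_le (by linarith) _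
      · refine ⟨1, zero_le_one, fun R h0 h1 => ?_⟩
        simp only [neg_zero, zero_div, Real.rpow_zero, one_mul]
        exact Real.rpow_le_one_of_one_le_of_nonpos (by linarith [two_le_logScale h0.le h1])
          (by linarith)
    refine MemLp.of_bound hu (|C| * K) ?_
    filter_upwards [ae_axisSq_pos hn] with x hx
    refine (hle x hx.1 hx.2).trans ?_
    have h2 := hK _ hx.2 (axisSq_lt_one hx.1).le
    have h3 := two_le_logScale hx.2.le (axisSq_lt_one hx.1).le
    have h4 : 0 ≤ axisSq x ^ (-α / 2) * logScale (axisSq x) ^ (-β) :=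
      mul_nonneg (Real.rpow_nonneg hx.2.le _) (Real.rpow_nonneg (by linarith) _)
    calc _ ≤ |C| * (axisSq x ^ (-α / 2) * logScale (axisSq x) ^ (-β)) := by
          gcongr; exact le_abs_self C
      _ ≤ _ := by gcongr
  · set σ := s.toReal
    have hσ : 0 < σ := ENNReal.toReal_pos hs hst
    have hσ' : (1 / s).toReal = 1 / σ := by simp [σ]
    rw [hσ'] at h
    obtain ⟨q, hq, K, hK0, hK⟩ : ∃ q : ℝ, 1 < q ∧ ∃ K, 0 ≤ K ∧ ∀ R, 0 < R → R ≤ 1 →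
        (R ^ (-α / 2) * logScale R ^ (-β)) ^ σ ≤ K * (R ^ (-(n : ℝ) / 2) * logScale R ^ (-q)) := by
      have hgen : ∀ q R : ℝ, 0 < R → R ≤ 1 → (R ^ (-α / 2) * logScale R ^ (-β)) ^ σ =
          (R ^ ((n - α * σ) / 2) * logScale R ^ (q - β * σ)) *
            (R ^ (-(n : ℝ) / 2) * logScale R ^ (-q)) := by
        intro q R h0 h1
        have hl : 0 < logScale R := by linarith [two_le_logScale h0.le h1]
        rw [Real.mul_rpow (by positivity) (by positivity), ← Real.rpow_mul h0.le,
          ← Real.rpow_mul hl.le, mul_mul_mul_comm, ← Real.rpow_add h0, ← Real.rpow_add hl]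
        congr 2 <;> ring
      rcases h with h | ⟨h, hβ⟩
      · have : 0 < (n - α * σ) / 2 := by
          have : α * σ < n := by
            rw [mul_one_div, lt_div_iff₀ hσ] at h; exact h
          linarith
        obtain ⟨K, hK0, hK⟩ := exists_rpow_mul_logScale_le this (2 - β * σ)
        refine ⟨2, one_lt_two, K, hK0, fun R h0 h1 => ?_⟩
        have hl : 0 < logScale R := by linarith [two_le_logScale h0.le h1]
        rw [hgen 2 R h0 h1]
        exact mul_le_mul_of_nonneg_right (hK R h0 h1) (by positivity)
      · refine ⟨β * σ, ?_, 1, zero_le_one, fun R h0 h1 => ?_⟩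
        · rw [div_lt_iff₀ hσ] at hβ; exact hβ
        · rw [hgen (β * σ) R h0 h1, h]
          rw [mul_one_div, div_mul_cancel₀ _ hσ.ne']
          simp
    rw [← memLp_norm_iff hu, ← integrable_norm_rpow_iff hu.norm hs hst]
    have hmeas : AEStronglyMeasurable (fun x => ‖‖u x‖‖ ^ s.toReal)
        (volume.restrict (Metric.ball (0 : EuclideanSpace ℝ (Fin (n + 1))) 1)) :=
      (hu.norm.norm.aemeasurable.pow_const _).aestronglyMeasurable
    refine ⟨hmeas, ?_⟩
    have hbig : HasFiniteIntegral (fun x : EuclideanSpace ℝ (Fin (n + 1)) => |C| ^ σ * K *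
        (axisSq x ^ (-(n : ℝ) / 2) * logScale (axisSq x) ^ (-q)))
        (volume.restrict (Metric.ball (0 : EuclideanSpace ℝ (Fin (n + 1))) 1)) := by
      apply HasFiniteIntegral.const_mul
      rw [hasFiniteIntegral_iff_ofReal]
      · exact lintegral_critical_lt_top n hq
      · filter_upwards [ae_axisSq_pos hn] with x hx
        have := two_le_logScale hx.2.le (axisSq_lt_one hx.1).le
        exact mul_nonneg (Real.rpow_nonneg hx.2.le _) (Real.rpow_nonneg (by linarith) _)
    refine hbig.mono ?_
    filter_upwards [ae_axisSq_pos hn] with x hx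
    have h1 := hle x hx.1 hx.2
    have h2 := hK _ hx.2 (axisSq_lt_one hx.1).le
    have h3 := two_le_logScale hx.2.le (axisSq_lt_one hx.1).le
    have h4 : 0 ≤ axisSq x ^ (-α / 2) * logScale (axisSq x) ^ (-β) :=
      mul_nonneg (Real.rpow_nonneg hx.2.le _) (Real.rpow_nonneg (by linarith) _)
    rw [norm_norm, Real.norm_eq_abs, Real.norm_eq_abs,
      abs_of_nonneg (Real.rpow_nonneg (abs_nonneg _) _)]
    refine le_trans ?_ (le_abs_self _)
    calc |u x| ^ s.toReal ≤ (|C| * (axisSq x ^ (-α / 2) * logScale (axisSq x) ^ (-β))) ^ σ := by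
          apply Real.rpow_le_rpow (abs_nonneg _) _ hσ.le
          exact h1.trans (mul_le_mul_of_nonneg_right (le_abs_self C) h4)
      _ = |C| ^ σ * (axisSq x ^ (-α / 2) * logScale (axisSq x) ^ (-β)) ^ σ :=
          Real.mul_rpow (abs_nonneg _) h4
      _ ≤ |C| ^ σ * (K * (axisSq x ^ (-(n : ℝ) / 2) * logScale (axisSq x) ^ (-q))) := by gcongr
      _ = _ := by ring

/-! ### Smooth steps -/

lemma hasDerivAt_smoothTransition (y : ℝ) :
    HasDerivAt Real.smoothTransition (deriv Real.smoothTransition y) y :=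
  ((Real.smoothTransition.contDiff (n := 1)).differentiable one_ne_zero y).hasDerivAt

lemma continuous_deriv_smoothTransition : Continuous (deriv Real.smoothTransition) :=
  (Real.smoothTransition.contDiff (n := 1)).continuous_deriv_one

lemma deriv_smoothTransition_of_nonpos {y : ℝ} (hy : y ≤ 0) :
    deriv Real.smoothTransition y = 0 := by
  apply IsLocalMin.deriv_eq_zero
  refine Eventually.of_forall fun z => ?_
  rw [Real.smoothTransition.zero_of_nonpos hy]
  exact Real.smoothTransition.nonneg z

lemma deriv_smoothTransition_of_one_le {y : ℝ} (hy : 1 ≤ y) :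
    deriv Real.smoothTransition y = 0 := by
  apply IsLocalMax.deriv_eq_zero
  refine Eventually.of_forall fun z => ?_
  rw [Real.smoothTransition.one_of_one_le hy]
  exact Real.smoothTransition.le_one z

lemma deriv_smoothTransition_nonneg (y : ℝ) : 0 ≤ deriv Real.smoothTransition y :=
  Real.smoothTransition.monotone.deriv_nonneg

lemma exists_deriv_smoothTransition_le :
    ∃ S, 0 ≤ S ∧ ∀ y, |deriv Real.smoothTransition y| ≤ S := by
  obtain ⟨S, hS⟩ := (isCompact_Icc (a := (0 : ℝ)) (b := 1)).exists_bound_of_continuousOn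
    continuous_deriv_smoothTransition.continuousOn
  refine ⟨max S 0, le_max_right _ _, fun y => ?_⟩
  rcases le_total y 0 with h | h
  · simp [deriv_smoothTransition_of_nonpos h]
  rcases le_total 1 y with h' | h'
  · simp [deriv_smoothTransition_of_one_le h']
  exact (hS y ⟨h, h'⟩).trans (le_max_left _ _)

/-! ### Integration by parts in the ball -/

lemma integrable_of_le_on_ball {g q : EuclideanSpace ℝ (Fin (n + 1)) → ℝ} (C : ℝ)
    (hq : IntegrableOn q (Metric.ball 0 1)) (hg : AEStronglyMeasurable g volume)
    (h0 : ∀ x ∉ Metric.ball 0 1, g x = 0) (hle : ∀ x ∈ Metric.ball 0 1, |g x| ≤ C * |q x|) :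
    Integrable g := by
  rw [← integrableOn_iff_integrable_of_support_subset (s := Metric.ball 0 1)]
  · refine Integrable.mono' (hq.norm.const_mul C) hg.restrict ?_
    rw [ae_restrict_iff' measurableSet_ball]
    exact Eventually.of_forall fun x hx => by simpa using hle x hx
  · intro x hx
    by_contra h
    exact hx (h0 x h)

/-- The `C¹` functions with compact support in the unit ball. -/
structure IsTest (ψ : EuclideanSpace ℝ (Fin (n + 1)) → ℝ) : Prop where
  contDiff : ContDiff ℝ 1 ψ
  hasCompactSupport : HasCompactSupport ψ
  tsupport_subset : tsupport ψ ⊆ Metric.ball 0 1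

/-- The partial derivative in the `i`-th coordinate. -/
def partialDeriv (i : Fin (n + 1)) (ψ : EuclideanSpace ℝ (Fin (n + 1)) → ℝ)
    (x : EuclideanSpace ℝ (Fin (n + 1))) : ℝ :=
  fderiv ℝ ψ x (EuclideanSpace.single i 1)

namespace IsTest

variable {ψ : EuclideanSpace ℝ (Fin (n + 1)) → ℝ}

lemma eq_zero (hψ : IsTest ψ) {x : EuclideanSpace ℝ (Fin (n + 1))} (hx : x ∉ Metric.ball 0 1) :
    ψ x = 0 :=
  image_eq_zero_of_notMem_tsupport fun h => hx (hψ.tsupport_subset h)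

lemma fderiv_eq_zero (hψ : IsTest ψ) {x : EuclideanSpace ℝ (Fin (n + 1))}
    (hx : x ∉ Metric.ball 0 1) : fderiv ℝ ψ x = 0 :=
  image_eq_zero_of_notMem_tsupport (f := fderiv ℝ ψ)
    fun h => hx (hψ.tsupport_subset (tsupport_fderiv_subset ℝ h))

lemma partialDeriv_eq_zero (hψ : IsTest ψ) (i : Fin (n + 1))
    {x : EuclideanSpace ℝ (Fin (n + 1))} (hx : x ∉ Metric.ball 0 1) : partialDeriv i ψ x = 0 := by
  simp [partialDeriv, hψ.fderiv_eq_zero hx]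

lemma continuous_partialDeriv (hψ : IsTest ψ) (i : Fin (n + 1)) :
    Continuous (partialDeriv i ψ) :=
  (hψ.contDiff.continuous_fderiv one_ne_zero).clm_apply continuous_const

lemma hasLineDerivAt (hψ : IsTest ψ) (i : Fin (n + 1)) (x : EuclideanSpace ℝ (Fin (n + 1))) :
    HasLineDerivAt ℝ ψ (partialDeriv i ψ x) x (EuclideanSpace.single i 1) :=
  (hψ.contDiff.differentiable one_ne_zero x).hasFDerivAt.hasLineDerivAt _

lemma exists_bound (hψ : IsTest ψ) : ∃ K, 0 ≤ K ∧ (∀ x, |ψ x| ≤ K) ∧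
    ∀ i x, |partialDeriv i ψ x| ≤ K := by
  obtain ⟨K₁, h₁⟩ := hψ.contDiff.continuous.bounded_above_of_compact_support hψ.hasCompactSupport
  obtain ⟨K₂, h₂⟩ := (hψ.contDiff.continuous_fderiv one_ne_zero).bounded_above_of_compact_support
    (hψ.hasCompactSupport.fderiv (𝕜 := ℝ))
  refine ⟨max K₁ K₂, ((norm_nonneg _).trans (h₁ 0)).trans (le_max_left _ _),
    fun x => (h₁ x).trans (le_max_left _ _), fun i x => ?_⟩
  calc |partialDeriv i ψ x| ≤ ‖fderiv ℝ ψ x‖ * ‖EuclideanSpace.single i (1 : ℝ)‖ :=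
        (fderiv ℝ ψ x).le_opNorm _
    _ ≤ _ := by simpa using (h₂ x).trans (le_max_right _ _)

end IsTest

lemma mul_apply_zero_le_abs {x : EuclideanSpace ℝ (Fin (n + 1))} (hx : x ∈ Metric.ball 0 1)
    (a : ℝ) : a * x 0 ≤ |a| := by
  calc a * x 0 ≤ |a * x 0| := le_abs_self _
    _ = |a| * |x 0| := abs_mul _ _
    _ ≤ |a| * 1 := by gcongr; exact (abs_zero_lt_one hx).le
    _ = |a| := mul_one _

/-- Integration by parts along the axis, for a field `q (r²) e ^ (a z)`; no regularity of `q` is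
needed. -/
lemma integral_mul_partialDeriv_zero {q : ℝ → ℝ} (hq : Measurable q)
    (hint : IntegrableOn (fun x : EuclideanSpace ℝ (Fin (n + 1)) => q (axisSq x))
      (Metric.ball 0 1)) (a : ℝ) {ψ : EuclideanSpace ℝ (Fin (n + 1)) → ℝ} (hψ : IsTest ψ) :
    Integrable (fun x => q (axisSq x) * Real.exp (a * x 0) * partialDeriv 0 ψ x) ∧
    Integrable (fun x => a * (q (axisSq x) * Real.exp (a * x 0)) * ψ x) ∧
    ∫ x, q (axisSq x) * Real.exp (a * x 0) * partialDeriv 0 ψ x =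
      -∫ x, a * (q (axisSq x) * Real.exp (a * x 0)) * ψ x := by
  obtain ⟨K, hK0, hK, hK'⟩ := hψ.exists_bound
  have hqm : Measurable fun x : EuclideanSpace ℝ (Fin (n + 1)) => q (axisSq x) :=
    hq.comp measurable_axisSq
  have hψm : Measurable ψ := hψ.contDiff.continuous.measurable
  have hdm : Measurable (partialDeriv 0 ψ) := (hψ.continuous_partialDeriv 0).measurable
  have hbd : ∀ x ∈ Metric.ball (0 : EuclideanSpace ℝ (Fin (n + 1))) 1, ∀ y, |y| ≤ K →
      |q (axisSq x) * Real.exp (a * x 0) * y| ≤ Real.exp |a| * K * |q (axisSq x)| := by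
    intro x hx y hy
    rw [abs_mul, abs_mul, Real.abs_exp]
    calc |q (axisSq x)| * Real.exp (a * x 0) * |y| ≤ |q (axisSq x)| * Real.exp |a| * K := by
          gcongr; exact mul_apply_zero_le_abs hx a
      _ = _ := by ring
  have h1 : Integrable (fun x => q (axisSq x) * Real.exp (a * x 0) * partialDeriv 0 ψ x) :=
    integrable_of_le_on_ball _ hint (Measurable.aestronglyMeasurable (by fun_prop))
      (fun x hx => by simp [hψ.partialDeriv_eq_zero 0 hx]) fun x hx => hbd x hx _ (hK' 0 x)
  have h2 : Integrable (fun x => q (axisSq x) * Real.exp (a * x 0) * ψ x) :=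
    integrable_of_le_on_ball _ hint (Measurable.aestronglyMeasurable (by fun_prop))
      (fun x hx => by simp [hψ.eq_zero hx]) fun x hx => hbd x hx _ (hK x)
  have h3 : Integrable (fun x => a * (q (axisSq x) * Real.exp (a * x 0)) * ψ x) := by
    simpa [mul_assoc] using h2.const_mul a
  refine ⟨h1, h3, ?_⟩
  refine integral_bilinear_hasLineDerivAt_right_eq_neg_left_of_integrable
    (B := ContinuousLinearMap.mul ℝ ℝ) (v := EuclideanSpace.single 0 1)
    (f := fun x : EuclideanSpace ℝ (Fin (n + 1)) => q (axisSq x) * Real.exp (a * x 0))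
    (f' := fun x => a * (q (axisSq x) * Real.exp (a * x 0)))
    (g := ψ) (g' := partialDeriv 0 ψ) h3 h1 h2 ?_ fun x _ => hψ.hasLineDerivAt 0 x
  intro x _
  have hax : ∀ t : ℝ, axisSq (x + t • EuclideanSpace.single (0 : Fin (n + 1)) (1 : ℝ)) =
      axisSq x := by
    intro t; simp [axisSq]
  unfold HasLineDerivAt
  simp only [hax]
  have : HasDerivAt (fun t : ℝ => a * (x 0 + t)) a 0 := by
    simpa using ((hasDerivAt_id (0 : ℝ)).const_add (x 0)).const_mul a
  have := (this.exp).const_mul (q (axisSq x))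
  simp only [add_zero] at this
  convert! this using 1
  · ext t; simp
  · ring

/-- Integration by parts in a direction orthogonal to the axis, for the `i`-th component of a field
`f (r²) e ^ (a z) x'`, where `2 R f' = (j - n) f`. It suffices that `f (r²)` is integrable: no mass
concentrates on the axis. -/
lemma integral_mul_partialDeriv_succ (hn : n ≠ 0) {f j : ℝ → ℝ} (hfm : Measurable f)
    (hjm : Measurable j)
    (hint : IntegrableOn (fun x : EuclideanSpace ℝ (Fin (n + 1)) => f (axisSq x))
      (Metric.ball 0 1))
    (hf : ∀ R, 0 < R → R < 1 → HasDerivAt f ((j R - n) * f R / (2 * R)) R)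
    {J : ℝ} (hJ : ∀ R, 0 < R → R < 1 → |j R| ≤ J) (a : ℝ)
    {ψ : EuclideanSpace ℝ (Fin (n + 1)) → ℝ} (hψ : IsTest ψ) (i : Fin n) :
    Integrable (fun x => f (axisSq x) * Real.exp (a * x 0) * x i.succ * partialDeriv i.succ ψ x) ∧
    Integrable (fun x => f (axisSq x) * Real.exp (a * x 0) *
        (1 + (j (axisSq x) - n) * x i.succ ^ 2 / axisSq x) * ψ x) ∧
    ∫ x, f (axisSq x) * Real.exp (a * x 0) * x i.succ * partialDeriv i.succ ψ x =
      -∫ x, f (axisSq x) * Real.exp (a * x 0) *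
        (1 + (j (axisSq x) - n) * x i.succ ^ 2 / axisSq x) * ψ x := by
  obtain ⟨K, hK0, hK, hK'⟩ := hψ.exists_bound
  obtain ⟨S, hS0, hS⟩ := exists_deriv_smoothTransition_le
  have hJ0 : 0 ≤ J := (abs_nonneg _).trans (hJ (1 / 2) (by norm_num) (by norm_num))
  have hax := measurable_axisSq (n := n)
  have hfm' := hfm.comp hax
  have hjm' := hjm.comp hax
  have hψm : Measurable ψ := hψ.contDiff.continuous.measurable
  have hdm : Measurable (partialDeriv i.succ ψ) := (hψ.continuous_partialDeriv _).measurable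
  have hsm : Measurable Real.smoothTransition := Real.smoothTransition.continuous.measurable
  have hsm' : Measurable (deriv Real.smoothTransition) :=
    continuous_deriv_smoothTransition.measurable
  set V : EuclideanSpace ℝ (Fin (n + 1)) → ℝ :=
    fun x => f (axisSq x) * Real.exp (a * x 0) * x i.succ with hV
  set V' : EuclideanSpace ℝ (Fin (n + 1)) → ℝ := fun x => f (axisSq x) * Real.exp (a * x 0) *
        (1 + (j (axisSq x) - n) * x i.succ ^ 2 / axisSq x) with hV'
  have hVm : Measurable V := by
    simp only [hV, Function.comp_def] at *; fun_prop
  have hVm' : Measurable V' := by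
    simp only [hV', Function.comp_def] at *; fun_prop
  -- the cutoffs `η m`, vanishing near the axis
  set η : ℕ → EuclideanSpace ℝ (Fin (n + 1)) → ℝ :=
    fun m x => Real.smoothTransition ((m + 1) * axisSq x - 1) with hη
  set η' : ℕ → EuclideanSpace ℝ (Fin (n + 1)) → ℝ :=
    fun m x => (m + 1) * deriv Real.smoothTransition ((m + 1) * axisSq x - 1) * (2 * x i.succ)
    with hη'
  have hηm : ∀ m, Measurable (η m) := fun m => by
    simp only [hη]; fun_prop
  have hηm' : ∀ m, Measurable (η' m) := fun m => by
    simp only [hη']; fun_prop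
  have hη0 : ∀ m x, 0 ≤ η m x := fun m x => Real.smoothTransition.nonneg _
  have hη1 : ∀ m x, η m x ≤ 1 := fun m x => Real.smoothTransition.le_one _
  have hxi : ∀ x ∈ Metric.ball (0 : EuclideanSpace ℝ (Fin (n + 1))) 1, |x i.succ| ≤ 1 := by
    intro x hx
    rw [← sq_le_one_iff_abs_le_one]
    exact (sq_le_axisSq x i).trans (axisSq_lt_one hx).le
  have hxiη : ∀ m, ∀ x ∈ Metric.ball (0 : EuclideanSpace ℝ (Fin (n + 1))) 1,
      |x i.succ * η' m x| ≤ 4 * S := by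
    intro m x hx
    have hm : (0 : ℝ) < m + 1 := by positivity
    have hR := axisSq_nonneg x
    rcases le_total 1 ((m + 1) * axisSq x - 1) with h | h
    · simp [hη', deriv_smoothTransition_of_one_le h, hS0]
    · have e : x i.succ * η' m x = 2 * ((m + 1) * x i.succ ^ 2) *
          deriv Real.smoothTransition ((m + 1) * axisSq x - 1) := by simp only [hη']; ring
      rw [e, abs_mul, abs_of_nonneg (by positivity)]
      have h5 : (m + 1) * x i.succ ^ 2 ≤ 2 := by
        have := mul_le_mul_of_nonneg_left (sq_le_axisSq x i) hm.le
        linarith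
      have := hS ((m + 1) * axisSq x - 1)
      calc 2 * ((m + 1) * x i.succ ^ 2) * |deriv Real.smoothTransition ((m + 1) * axisSq x - 1)|
          ≤ 2 * 2 * S := by gcongr
        _ = 4 * S := by ring
  have hE : ∀ x ∈ Metric.ball (0 : EuclideanSpace ℝ (Fin (n + 1))) 1, ∀ y M : ℝ, |y| ≤ M →
      |f (axisSq x) * Real.exp (a * x 0) * y| ≤ Real.exp |a| * M * |f (axisSq x)| := by
    intro x hx y M hy
    rw [abs_mul, abs_mul, Real.abs_exp]
    calc |f (axisSq x)| * Real.exp (a * x 0) * |y| ≤ |f (axisSq x)| * Real.exp |a| * M := by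
          gcongr; exact mul_apply_zero_le_abs hx a
      _ = _ := by ring
  have hq : ∀ x ∈ Metric.ball (0 : EuclideanSpace ℝ (Fin (n + 1))) 1,
      |1 + (j (axisSq x) - n) * x i.succ ^ 2 / axisSq x| ≤ 1 + (J + n) := by
    intro x hx
    have hR := axisSq_nonneg x
    rcases hR.eq_or_lt with h | h
    · rw [← h]; simp; positivity
    · have h1 : |x i.succ ^ 2 / axisSq x| ≤ 1 := by
        rw [abs_of_nonneg (by positivity), div_le_one h]; exact sq_le_axisSq x i
      have h2 : |j (axisSq x) - n| ≤ J + n := by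
        refine (abs_sub _ _).trans ?_
        rw [Nat.abs_cast]
        gcongr; exact hJ _ h (axisSq_lt_one hx)
      calc _ ≤ |(1 : ℝ)| + |(j (axisSq x) - n) * x i.succ ^ 2 / axisSq x| := abs_add_le _ _
        _ = 1 + |j (axisSq x) - n| * |x i.succ ^ 2 / axisSq x| := by
            rw [abs_one, mul_div_assoc, abs_mul]
        _ ≤ 1 + (J + n) * 1 := by gcongr
        _ = _ := by ring
  set ψη : ℕ → EuclideanSpace ℝ (Fin (n + 1)) → ℝ := fun m x => ψ x * η m x with hψη
  set ψη' : ℕ → EuclideanSpace ℝ (Fin (n + 1)) → ℝ :=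
    fun m x => partialDeriv i.succ ψ x * η m x + ψ x * η' m x with hψη'
  have hψη0 : ∀ m, ∀ x ∉ Metric.ball 0 1, ψη m x = 0 := fun m x hx => by
    simp [hψη, hψ.eq_zero hx]
  have hψη0' : ∀ m, ∀ x ∉ Metric.ball 0 1, ψη' m x = 0 := fun m x hx => by
    simp [hψη', hψ.eq_zero hx, hψ.partialDeriv_eq_zero _ hx]
  have hψηK : ∀ m x, |ψη m x| ≤ K := fun m x => by
    rw [hψη, abs_mul, abs_of_nonneg (hη0 m x)]
    exact (mul_le_mul (hK x) (hη1 m x) (hη0 m x) hK0).trans_eq (mul_one K)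
  have hb1 : ∀ m, ∀ x ∈ Metric.ball (0 : EuclideanSpace ℝ (Fin (n + 1))) 1,
      |V' x * ψη m x| ≤ Real.exp |a| * ((1 + (J + n)) * K) * |f (axisSq x)| := by
    intro m x hx
    rw [hV', mul_assoc]
    apply hE x hx
    rw [abs_mul]
    exact mul_le_mul (hq x hx) (hψηK m x) (abs_nonneg _) (by positivity)
  have hb2 : ∀ m, ∀ x ∈ Metric.ball (0 : EuclideanSpace ℝ (Fin (n + 1))) 1,
      |V x * ψη' m x| ≤ Real.exp |a| * (K + K * (4 * S)) * |f (axisSq x)| := by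
    intro m x hx
    rw [hV, mul_assoc]
    apply hE x hx
    rw [hψη', show x i.succ * (partialDeriv i.succ ψ x * η m x + ψ x * η' m x) =
      x i.succ * partialDeriv i.succ ψ x * η m x + ψ x * (x i.succ * η' m x) by ring]
    refine (abs_add_le _ _).trans (add_le_add ?_ ?_)
    · rw [abs_mul, abs_mul, abs_of_nonneg (hη0 m x)]
      calc _ ≤ 1 * K * 1 := by
            gcongr
            · exact hη0 m x
            · exact hxi x hx
            · exact hK' _ x
            · exact hη1 m x
        _ = K := by ring
    · rw [abs_mul]
      exact mul_le_mul (hK x) (hxiη m x hx) (abs_nonneg _) hK0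
  have hψηm : ∀ m, Measurable (ψη m) := fun m => hψm.mul (hηm m)
  have hψηm' : ∀ m, Measurable (ψη' m) := fun m =>
    (hdm.mul (hηm m)).add (hψm.mul (hηm' m))
  have hi1 : ∀ m, Integrable fun x => V' x * ψη m x := fun m =>
    integrable_of_le_on_ball _ hint (hVm'.mul (hψηm m)).aestronglyMeasurable
      (fun x hx => by rw [hψη0 m x hx, mul_zero]) (hb1 m)
  have hi2 : ∀ m, Integrable fun x => V x * ψη' m x := fun m =>
    integrable_of_le_on_ball _ hint (hVm.mul (hψηm' m)).aestronglyMeasurable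
      (fun x hx => by rw [hψη0' m x hx, mul_zero]) (hb2 m)
  have hi3 : ∀ m, Integrable fun x => V x * ψη m x := fun m =>
    integrable_of_le_on_ball (Real.exp |a| * (1 * K)) hint
      (hVm.mul (hψηm m)).aestronglyMeasurable
      (fun x hx => by rw [hψη0 m x hx, mul_zero]) fun x hx => by
        rw [hV, mul_assoc]
        apply hE x hx
        rw [abs_mul]
        exact mul_le_mul (hxi x hx) (hψηK m x) (abs_nonneg _) zero_le_one
  have hline : ∀ x : EuclideanSpace ℝ (Fin (n + 1)), HasDerivAt
      (fun t : ℝ => axisSq (x + t • EuclideanSpace.single i.succ (1 : ℝ))) (2 * x i.succ) 0 := by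
    intro x
    have h : HasDerivAt (fun t : ℝ => ∑ k : Fin n,
        ((x + t • EuclideanSpace.single i.succ (1 : ℝ)) k.succ) ^ 2)
        (∑ k : Fin n, if k = i then 2 * x i.succ else 0) 0 := by
      refine HasDerivAt.fun_sum fun k _ => ?_
      by_cases hk : k = i
      · subst hk
        have := ((hasDerivAt_id (0 : ℝ)).const_add (x k.succ)).pow 2
        convert! this using 1
        · ext t; simp
        · simp
      · have : (fun t : ℝ => ((x + t • EuclideanSpace.single i.succ (1 : ℝ)) k.succ) ^ 2) =
            fun _ => x k.succ ^ 2 := by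
          ext t; simp [hk]
        rw [this, if_neg hk]
        exact hasDerivAt_const _ _
    simpa [axisSq] using h
  have hibp : ∀ m, ∫ x, V x * ψη' m x = -∫ x, V' x * ψη m x := by
    intro m
    have hm : (0 : ℝ) < m + 1 := by positivity
    have hzero : ∀ x : EuclideanSpace ℝ (Fin (n + 1)),
        x + (0 : ℝ) • EuclideanSpace.single i.succ (1 : ℝ) = x := fun x => by simp
    refine integral_bilinear_hasLineDerivAt_right_eq_neg_left_of_integrable
      (B := ContinuousLinearMap.mul ℝ ℝ) (v := EuclideanSpace.single i.succ 1)
      (f := V) (f' := V') (g := ψη m) (g' := ψη' m) (hi1 m) (hi2 m) (hi3 m) ?_ ?_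
    · intro x hx
      have hxb : x ∈ Metric.ball (0 : EuclideanSpace ℝ (Fin (n + 1))) 1 :=
        hψ.tsupport_subset (tsupport_mul_subset_left hx)
      have hxR : 1 / (m + 1) ≤ axisSq x := by
        have hcl : IsClosed {x : EuclideanSpace ℝ (Fin (n + 1)) | 1 / ((m : ℝ) + 1) ≤ axisSq x} :=
          isClosed_le continuous_const continuous_axisSq
        refine closure_minimal ?_ hcl hx
        intro y hy
        by_contra hlt
        apply hy
        have : η m y = 0 := by
          apply Real.smoothTransition.zero_of_nonpos
          have hlt' : axisSq y < 1 / ((m : ℝ) + 1) := not_le.1 hlt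
          rw [lt_div_iff₀ hm] at hlt'
          linarith
        simp [hψη, this]
      have hpos : 0 < axisSq x := lt_of_lt_of_le (by positivity) hxR
      have h1 := hline x
      have h2 : HasDerivAt f ((j (axisSq x) - n) * f (axisSq x) / (2 * axisSq x))
          (axisSq (x + (0 : ℝ) • EuclideanSpace.single i.succ (1 : ℝ))) := by
        rw [hzero]; exact hf _ hpos (axisSq_lt_one hxb)
      have h3 := h2.comp (0 : ℝ) h1
      have h4 : HasDerivAt (fun t : ℝ => x i.succ + t) 1 0 :=
        (hasDerivAt_id (0 : ℝ)).const_add (x i.succ)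
      have h5 := (h3.mul_const (Real.exp (a * x 0))).mul h4
      unfold HasLineDerivAt
      convert! h5 using 1
      · ext t; simp [hV]
      · simp only [hV', Function.comp_apply, hzero]
        field_simp
        ring
    · intro x _
      have h1 : HasDerivAt (fun t : ℝ =>
          (m + 1) * axisSq (x + t • EuclideanSpace.single i.succ (1 : ℝ)) - 1)
          ((m + 1) * (2 * x i.succ)) 0 := ((hline x).const_mul _).sub_const 1
      have h2 := (hasDerivAt_smoothTransition ((m + 1) *
        axisSq (x + (0 : ℝ) • EuclideanSpace.single i.succ (1 : ℝ)) - 1)).comp (0 : ℝ) h1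
      have h3 := HasDerivAt.mul (hψ.hasLineDerivAt i.succ x) h2
      unfold HasLineDerivAt
      convert! h3 using 1
      simp only [hψη', hη, hη', Function.comp_apply, hzero]
      ring
  -- removal of the cutoffs
  have hlimη : ∀ x : EuclideanSpace ℝ (Fin (n + 1)), 0 < axisSq x →
      ∀ᶠ m : ℕ in atTop, η m x = 1 ∧ η' m x = 0 := by
    intro x hx
    obtain ⟨N, hN⟩ := exists_nat_gt (2 / axisSq x)
    filter_upwards [eventually_ge_atTop N] with m hm
    have : 1 ≤ (m + 1) * axisSq x - 1 := by
      rw [div_lt_iff₀ hx] at hN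
      have : (N : ℝ) ≤ m := by exact_mod_cast hm
      nlinarith
    simp [hη, hη', Real.smoothTransition.one_of_one_le this, deriv_smoothTransition_of_one_le this]
  have hae : ∀ᵐ x : EuclideanSpace ℝ (Fin (n + 1)), x ∈ Metric.ball 0 1 → 0 < axisSq x := by
    have := ae_axisSq_pos hn
    rw [ae_restrict_iff' measurableSet_ball] at this
    filter_upwards [this] with x hx hx' using (hx hx').2
  have hdom : ∀ M : ℝ, Integrable ((Metric.ball 0 1).indicator
      fun x : EuclideanSpace ℝ (Fin (n + 1)) => M * |f (axisSq x)|) := fun M =>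
    (integrable_indicator_iff measurableSet_ball).2 (hint.norm.const_mul M)
  have hdomle : ∀ {g : EuclideanSpace ℝ (Fin (n + 1)) → ℝ} {M : ℝ},
      (∀ x ∉ Metric.ball 0 1, g x = 0) → (∀ x ∈ Metric.ball 0 1, |g x| ≤ M * |f (axisSq x)|) →
      ∀ᵐ x, ‖g x‖ ≤ (Metric.ball 0 1).indicator
        (fun x : EuclideanSpace ℝ (Fin (n + 1)) => M * |f (axisSq x)|) x := by
    intro g M h0 h1
    refine Eventually.of_forall fun x => ?_
    by_cases hx : x ∈ Metric.ball (0 : EuclideanSpace ℝ (Fin (n + 1))) 1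
    · rw [Set.indicator_of_mem hx]; exact h1 x hx
    · rw [Set.indicator_of_notMem hx, h0 x hx, norm_zero]
  have hlimL : Tendsto (fun m => ∫ x, V x * ψη' m x) atTop
      (𝓝 (∫ x, V x * partialDeriv i.succ ψ x)) := by
    refine tendsto_integral_of_dominated_convergence _
      (fun m => (hVm.mul (hψηm' m)).aestronglyMeasurable) (hdom _)
      (fun m => hdomle (fun x hx => by rw [hψη0' m x hx, mul_zero]) (hb2 m)) ?_
    filter_upwards [hae] with x hx
    by_cases hxb : x ∈ Metric.ball (0 : EuclideanSpace ℝ (Fin (n + 1))) 1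
    · apply tendsto_const_nhds.congr'
      filter_upwards [hlimη x (hx hxb)] with m hm
      simp [hψη', hm.1, hm.2]
    · simp [hψη0' _ x hxb, hψ.partialDeriv_eq_zero _ hxb]
  have hlimR : Tendsto (fun m => ∫ x, V' x * ψη m x) atTop (𝓝 (∫ x, V' x * ψ x)) := by
    refine tendsto_integral_of_dominated_convergence _
      (fun m => (hVm'.mul (hψηm m)).aestronglyMeasurable) (hdom _)
      (fun m => hdomle (fun x hx => by rw [hψη0 m x hx, mul_zero]) (hb1 m)) ?_
    filter_upwards [hae] with x hx
    by_cases hxb : x ∈ Metric.ball (0 : EuclideanSpace ℝ (Fin (n + 1))) 1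
    · apply tendsto_const_nhds.congr'
      filter_upwards [hlimη x (hx hxb)] with m hm
      simp [hψη, hm.1]
    · simp [hψη0 _ x hxb, hψ.eq_zero hxb]
  refine ⟨?_, ?_, tendsto_nhds_unique hlimL ?_⟩
  · refine integrable_of_le_on_ball (Real.exp |a| * (1 * K)) hint
      (hVm.mul hdm).aestronglyMeasurable
      (fun x hx => by rw [hψ.partialDeriv_eq_zero _ hx, mul_zero]) fun x hx => ?_
    rw [mul_assoc]
    apply hE x hx
    rw [abs_mul]
    exact mul_le_mul (hxi x hx) (hK' _ x) (abs_nonneg _) zero_le_one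
  · refine integrable_of_le_on_ball (Real.exp |a| * ((1 + (J + n)) * K)) hint
      (hVm'.mul hψm).aestronglyMeasurable
      (fun x hx => by rw [hψ.eq_zero hx, mul_zero]) fun x hx => ?_
    rw [mul_assoc]
    apply hE x hx
    rw [abs_mul]
    exact mul_le_mul (hq x hx) (hK x) (abs_nonneg _) (by positivity)
  · simp only [hibp]
    exact hlimR.neg

/-! ### The energy norm of the weighted `p`-Laplacian -/

section Energy

variable {d : ℕ}

lemma inner_pLaplaceField_self (w : EuclideanSpace ℝ (Fin d) → ℝ) (p : ℝ)
    (x : EuclideanSpace ℝ (Fin d)) {ξ : EuclideanSpace ℝ (Fin d)} (hξ : ξ ≠ 0) :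
    inner ℝ (pLaplaceField w p x ξ) ξ = w x * ‖ξ‖ ^ p := by
  have hpos : 0 < ‖ξ‖ := norm_pos_iff.2 hξ
  rw [pLaplaceField, real_inner_smul_left, real_inner_self_eq_norm_sq, mul_assoc,
    ← Real.rpow_natCast, ← Real.rpow_add hpos]
  congr 2; push_cast; ring

lemma norm_pLaplaceField {w : EuclideanSpace ℝ (Fin d) → ℝ} (p : ℝ)
    {x : EuclideanSpace ℝ (Fin d)} (hw : 0 < w x) {ξ : EuclideanSpace ℝ (Fin d)} (hξ : ξ ≠ 0) :
    ‖pLaplaceField w p x ξ‖ = w x * ‖ξ‖ ^ (p - 1) := by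
  have hpos : 0 < ‖ξ‖ := norm_pos_iff.2 hξ
  rw [pLaplaceField, norm_smul, Real.norm_eq_abs, abs_of_nonneg (by positivity), mul_assoc]
  nth_rw 2 [← Real.rpow_one ‖ξ‖]
  rw [← Real.rpow_add hpos]
  congr 2; ring

lemma lowerEllipticity_pLaplaceField (hd : d ≠ 0) {w : EuclideanSpace ℝ (Fin d) → ℝ} (p : ℝ)
    {x : EuclideanSpace ℝ (Fin d)} (hw : 0 < w x) :
    lowerEllipticity (pLaplaceField w p) p x = ENNReal.ofReal (w x) := by
  have : NeZero d := ⟨hd⟩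
  have h : ∀ ξ : EuclideanSpace ℝ (Fin d), ξ ≠ 0 →
      ENNReal.ofReal (inner ℝ (pLaplaceField w p x ξ) ξ) / ‖ξ‖ₑ ^ p = ENNReal.ofReal (w x) := by
    intro ξ hξ
    have hpos : 0 < ‖ξ‖ := norm_pos_iff.2 hξ
    rw [inner_pLaplaceField_self w p x hξ, ← ofReal_norm, ENNReal.ofReal_rpow_of_pos hpos,
      ← ENNReal.ofReal_div_of_pos (by positivity)]
    congr 1
    field_simp
  unfold lowerEllipticity
  apply le_antisymm
  · have hne : EuclideanSpace.single (0 : Fin d) (1 : ℝ) ≠ 0 := by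
      simp
    exact (iInf₂_le (f := fun ξ (_ : ξ ≠ 0) =>
      ENNReal.ofReal (inner ℝ (pLaplaceField w p x ξ) ξ) / ‖ξ‖ₑ ^ p) _ hne).trans (h _ hne).le
  · exact le_iInf₂ fun ξ hξ => (h ξ hξ).ge

lemma upperEllipticity_pLaplaceField (hd : d ≠ 0) {w : EuclideanSpace ℝ (Fin d) → ℝ} (p : ℝ)
    {x : EuclideanSpace ℝ (Fin d)} (hw : 0 < w x) :
    upperEllipticity (pLaplaceField w p) p x = ENNReal.ofReal (w x) := by
  have : NeZero d := ⟨hd⟩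
  have h : ∀ ξ : EuclideanSpace ℝ (Fin d), ξ ≠ 0 →
      ‖pLaplaceField w p x ξ‖ₑ ^ p /
        ENNReal.ofReal (inner ℝ (pLaplaceField w p x ξ) ξ) ^ (p - 1) = ENNReal.ofReal (w x) := by
    intro ξ hξ
    have hpos : 0 < ‖ξ‖ := norm_pos_iff.2 hξ
    have h1 : 0 < w x * ‖ξ‖ ^ (p - 1) := by positivity
    have h2 : 0 < w x * ‖ξ‖ ^ p := by positivity
    rw [inner_pLaplaceField_self w p x hξ, ← ofReal_norm, norm_pLaplaceField p hw hξ,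
      ENNReal.ofReal_rpow_of_pos h1, ENNReal.ofReal_rpow_of_pos h2,
      ← ENNReal.ofReal_div_of_pos (by positivity)]
    congr 1
    rw [Real.mul_rpow hw.le (by positivity), Real.mul_rpow hw.le (by positivity),
      ← Real.rpow_mul hpos.le, ← Real.rpow_mul hpos.le, mul_comm (p - 1) p,
      mul_div_mul_right _ _ (by positivity), ← Real.rpow_sub hw]
    simp
  unfold upperEllipticity
  apply le_antisymm
  · exact iSup₂_le fun ξ hξ => (h ξ hξ).le
  · have hne : EuclideanSpace.single (0 : Fin d) (1 : ℝ) ≠ 0 := by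
      simp
    exact (h _ hne).ge.trans (le_iSup₂ (f := fun ξ (_ : ξ ≠ 0) =>
      ‖pLaplaceField w p x ξ‖ₑ ^ p /
        ENNReal.ofReal (inner ℝ (pLaplaceField w p x ξ) ξ) ^ (p - 1)) _ hne)

lemma energyNorm_pLaplaceField (hd : d ≠ 0) {w : EuclideanSpace ℝ (Fin d) → ℝ} (p : ℝ)
    {Ω : Set (EuclideanSpace ℝ (Fin d))} (hΩ : MeasurableSet Ω) (hw : ∀ x ∈ Ω, 0 < w x)
    (u : EuclideanSpace ℝ (Fin d) → ℝ) (G : EuclideanSpace ℝ (Fin d) → EuclideanSpace ℝ (Fin d)) :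
    energyNorm Ω (pLaplaceField w p) p u G =
      (∫⁻ x in Ω, (ENNReal.ofReal (w x) * ‖G x‖ₑ ^ p + ENNReal.ofReal (w x) * ‖u x‖ₑ ^ p))
        ^ (1 / p) := by
  unfold energyNorm
  congr 1
  refine setLIntegral_congr_fun hΩ fun x hx => ?_
  simp only [lowerEllipticity_pLaplaceField hd p (hw x hx),
    upperEllipticity_pLaplaceField hd p (hw x hx)]

end Energy

/-! ### Passing to the limit in weighted duality pairings -/

/-- Hölder's inequality with a weight. -/
lemma lintegral_weight_mul_le {α : Type*} [MeasurableSpace α] {μ : Measure α} {p : ℝ} (hp : 1 < p)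
    {W g e : α → ℝ≥0∞} (hW : AEMeasurable W μ) (hg : AEMeasurable g μ) (he : AEMeasurable e μ) :
    ∫⁻ x, W x * g x ^ (p - 1) * e x ∂μ ≤
      (∫⁻ x, W x * g x ^ p ∂μ) ^ (1 / (p / (p - 1))) * (∫⁻ x, W x * e x ^ p ∂μ) ^ (1 / p) := by
  have hp1 : 0 < p - 1 := by linarith
  have hp0 : 0 < p := by linarith
  set q := p / (p - 1) with hq
  have hq0 : 0 < q := by positivity
  have hpq : q.HolderConjugate p := (Real.HolderConjugate.conjExponent hp).symm
  have h := ENNReal.lintegral_mul_le_Lp_mul_Lq μ hpq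
    (f := fun x => W x ^ (1 / q) * g x ^ (p - 1)) (g := fun x => W x ^ (1 / p) * e x)
    ((hW.pow_const _).mul (hg.pow_const _)) ((hW.pow_const _).mul he)
  have e1 : ∀ x, ((fun x => W x ^ (1 / q) * g x ^ (p - 1)) * fun x => W x ^ (1 / p) * e x) x =
      W x * g x ^ (p - 1) * e x := by
    intro x
    have : W x = W x ^ (1 / q) * W x ^ (1 / p) := by
      rw [← ENNReal.rpow_add_of_nonneg _ _ (by positivity) (by positivity)]
      have := hpq.inv_add_inv_eq_one
      simp only [one_div, this, ENNReal.rpow_one]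
    simp only [Pi.mul_apply]
    nth_rw 3 [this]
    ring
  have e2 : ∀ x, (W x ^ (1 / q) * g x ^ (p - 1)) ^ q = W x * g x ^ p := by
    intro x
    rw [ENNReal.mul_rpow_of_nonneg _ _ hq0.le, ← ENNReal.rpow_mul, ← ENNReal.rpow_mul,
      one_div_mul_cancel hq0.ne', ENNReal.rpow_one, hq, mul_div_cancel₀ _ hp1.ne']
  have e3 : ∀ x, (W x ^ (1 / p) * e x) ^ p = W x * e x ^ p := by
    intro x
    rw [ENNReal.mul_rpow_of_nonneg _ _ hp0.le, ← ENNReal.rpow_mul,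
      one_div_mul_cancel hp0.ne', ENNReal.rpow_one]
  simpa only [e1, e2, e3] using h

/-- A field dominated by `W g ^ (p - 1)`, where `g` has finite weighted `L^p` norm, acts
continuously on the weighted `L^p` space. -/
lemma tendsto_integral_inner_of_weighted {α F : Type*} [MeasurableSpace α] {μ : Measure α}
    [NormedAddCommGroup F] [InnerProductSpace ℝ F] {p : ℝ} (hp : 1 < p)
    {W g : α → ℝ≥0∞} (hW : AEMeasurable W μ) (hg : AEMeasurable g μ)
    {Y Z : α → F} {Zn : ℕ → α → F} (hY : AEStronglyMeasurable Y μ) (hZ : AEStronglyMeasurable Z μ)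
    (hZn : ∀ m, AEStronglyMeasurable (Zn m) μ) {A : ℝ≥0∞} (hA : A ≠ ∞)
    (hle : ∀ᵐ x ∂μ, ‖Y x‖ₑ ≤ A * (W x * g x ^ (p - 1)))
    (hgp : ∫⁻ x, W x * g x ^ p ∂μ ≠ ∞)
    (hfin : ∀ m, ∫⁻ x, W x * ‖Zn m x‖ₑ ^ p ∂μ ≠ ∞)
    (hlim : Tendsto (fun m => ∫⁻ x, W x * ‖Zn m x - Z x‖ₑ ^ p ∂μ) atTop (𝓝 0)) :
    Integrable (fun x => inner ℝ (Y x) (Z x)) μ ∧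
    Tendsto (fun m => ∫ x, inner ℝ (Y x) (Zn m x) ∂μ) atTop (𝓝 (∫ x, inner ℝ (Y x) (Z x) ∂μ)) := by
  have hp0 : 0 < p := by linarith
  set B := A * (∫⁻ x, W x * g x ^ p ∂μ) ^ (1 / (p / (p - 1))) with hB
  have hBfin : B ≠ ∞ := by
    refine ENNReal.mul_ne_top hA (ENNReal.rpow_ne_top_of_nonneg ?_ hgp)
    have : 0 < p - 1 := by linarith
    positivity
  have key : ∀ U : α → F, AEStronglyMeasurable U μ →
      ∫⁻ x, ‖(inner ℝ (Y x) (U x) : ℝ)‖ₑ ∂μ ≤ B * (∫⁻ x, W x * ‖U x‖ₑ ^ p ∂μ) ^ (1 / p) := by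
    intro U hU
    calc _ ≤ ∫⁻ x, A * (W x * g x ^ (p - 1) * ‖U x‖ₑ) ∂μ := by
          refine lintegral_mono_ae ?_
          filter_upwards [hle] with x hx
          calc _ ≤ ‖Y x‖ₑ * ‖U x‖ₑ := by
                rw [← ofReal_norm, ← ofReal_norm, ← ofReal_norm,
                  ← ENNReal.ofReal_mul (norm_nonneg _)]
                exact ENNReal.ofReal_le_ofReal (norm_inner_le_norm _ _)
            _ ≤ A * (W x * g x ^ (p - 1)) * ‖U x‖ₑ := by gcongr
            _ = _ := by ring
      _ = A * ∫⁻ x, W x * g x ^ (p - 1) * ‖U x‖ₑ ∂μ := lintegral_const_mul' _ _ hA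
      _ ≤ A * ((∫⁻ x, W x * g x ^ p ∂μ) ^ (1 / (p / (p - 1))) *
          (∫⁻ x, W x * ‖U x‖ₑ ^ p ∂μ) ^ (1 / p)) :=
          mul_le_mul_right (lintegral_weight_mul_le hp hW hg hU.enorm) A
      _ = _ := by rw [hB, mul_assoc]
  have hYZn : ∀ m, Integrable (fun x => (inner ℝ (Y x) (Zn m x) : ℝ)) μ := fun m =>
    ⟨hY.inner (hZn m), (key _ (hZn m)).trans_lt
      (ENNReal.mul_lt_top hBfin.lt_top
        (ENNReal.rpow_lt_top_of_nonneg (by positivity) (hfin m)))⟩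
  have hdiff : Tendsto (fun m => ∫⁻ x, ‖(inner ℝ (Y x) (Zn m x) : ℝ) - inner ℝ (Y x) (Z x)‖ₑ ∂μ)
      atTop (𝓝 0) := by
    have h1 : Tendsto (fun m => B * (∫⁻ x, W x * ‖Zn m x - Z x‖ₑ ^ p ∂μ) ^ (1 / p)) atTop
        (𝓝 0) := by
      have := ENNReal.Tendsto.const_mul (hlim.ennrpow_const (1 / p)) (Or.inr hBfin)
      simpa [hp0] using this
    refine tendsto_of_tendsto_of_tendsto_of_le_of_le tendsto_const_nhds h1 (fun _ => zero_le)
      fun m => ?_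
    simp only [← inner_sub_right]
    exact key _ ((hZn m).sub hZ)
  have hYZ : Integrable (fun x => (inner ℝ (Y x) (Z x) : ℝ)) μ := by
    obtain ⟨m, hm⟩ := (hdiff.eventually (gt_mem_nhds one_pos)).exists
    have hd : Integrable (fun x => (inner ℝ (Y x) (Zn m x) : ℝ) - inner ℝ (Y x) (Z x)) μ :=
      ⟨(hY.inner (hZn m)).sub (hY.inner hZ), hm.trans ENNReal.one_lt_top⟩
    exact ((hYZn m).sub hd).congr (Eventually.of_forall fun x => by simp)
  exact ⟨hYZ, tendsto_integral_of_L1 _ hYZ.1 (Eventually.of_forall hYZn) hdiff⟩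

/-! ### Subsolutions `e ^ (c z) φ (r²)` -/

/-- The data of a subsolution `e ^ (c z) φ (r²)` in the unit ball of `ℝ^(n+1)`, where `z` is the
coordinate along the axis and `r` the distance to it. All functions depend on `R = r²`; `k` is the
logarithmic slope of `φ`, and `f` the profile of the flux orthogonal to the axis, whose divergence
is governed by `j`. The inequality `j k ≤ (p - 1) c²` is the subsolution property. -/
structure Profile (n : ℕ) (p c : ℝ) where
  /-- the radial factor of the subsolution -/
  φ : ℝ → ℝ
  /-- the logarithmic slope of `φ` -/
  k : ℝ → ℝ
  /-- the radial factor of the flux -/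
  f : ℝ → ℝ
  /-- the radial factor of the divergence of the flux -/
  j : ℝ → ℝ
  /-- a bound for `k R` and for `|j| k` in the unit ball -/
  K : ℝ
  measurable_φ : Measurable φ
  measurable_k : Measurable k
  measurable_f : Measurable f
  measurable_j : Measurable j
  contDiffAt_φ : ∀ R, 0 < R → ContDiffAt ℝ 1 φ R
  hasDerivAt_φ : ∀ R, 0 < R → HasDerivAt φ (-(φ R * k R) / 2) R
  hasDerivAt_f : ∀ R, 0 < R → R < 1 → HasDerivAt f ((j R - n) * f R / (2 * R)) R
  one_le_φ : ∀ R, 0 < R → R < 1 → 1 ≤ φ R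
  one_le_k : ∀ R, 0 < R → 1 ≤ k R
  f_pos : ∀ R, 0 < R → 0 < f R
  k_mul_le : ∀ R, 0 < R → R < 1 → k R * R ≤ K
  j_mul_k_le : ∀ R, 0 < R → R < 1 → j R * k R ≤ (p - 1) * c ^ 2
  abs_j_mul_k_le : ∀ R, 0 < R → R < 1 → |j R| * k R ≤ K
  tendsto_φ : Tendsto φ (𝓝[>] 0) atTop
  integrableOn : IntegrableOn (fun x : EuclideanSpace ℝ (Fin (n + 1)) =>
    φ (axisSq x) * f (axisSq x)) (Metric.ball 0 1)

variable {p c : ℝ}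

/-- The vector with component `a` along the axis and `b x'` orthogonal to it, where `x'` is the
projection of `x` orthogonal to the axis. -/
def axialVec (a b : ℝ) (x : EuclideanSpace ℝ (Fin (n + 1))) : EuclideanSpace ℝ (Fin (n + 1)) :=
  WithLp.toLp 2 (Fin.cons a fun i => b * x i.succ)

@[simp] lemma axialVec_zero (a b : ℝ) (x : EuclideanSpace ℝ (Fin (n + 1))) :
    axialVec a b x 0 = a := rfl

@[simp] lemma axialVec_succ (a b : ℝ) (x : EuclideanSpace ℝ (Fin (n + 1))) (i : Fin n) :
    axialVec a b x i.succ = b * x i.succ := rfl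

lemma norm_sq_axialVec (a b : ℝ) (x : EuclideanSpace ℝ (Fin (n + 1))) :
    ‖axialVec a b x‖ ^ 2 = a ^ 2 + b ^ 2 * axisSq x := by
  rw [norm_sq_eq_add_axisSq, axialVec_zero]
  simp [axisSq, mul_pow, Finset.mul_sum]

lemma smul_axialVec (t a b : ℝ) (x : EuclideanSpace ℝ (Fin (n + 1))) :
    t • axialVec a b x = axialVec (t * a) (t * b) x := by
  ext i
  refine Fin.cases ?_ (fun i => ?_) i <;> simp [mul_assoc]

lemma axialVec_sub (a b a' b' : ℝ) (x : EuclideanSpace ℝ (Fin (n + 1))) :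
    axialVec a b x - axialVec a' b' x = axialVec (a - a') (b - b') x := by
  ext i
  refine Fin.cases ?_ (fun i => ?_) i <;> simp [sub_mul]

lemma norm_axialVec_le {a b a' b' B : ℝ} (hB : 0 ≤ B) (ha : |a| ≤ B * |a'|) (hb : |b| ≤ B * |b'|)
    (x : EuclideanSpace ℝ (Fin (n + 1))) :
    ‖axialVec a b x‖ ≤ B * ‖axialVec a' b' x‖ := by
  apply le_of_sq_le_sq _ (by positivity)
  rw [mul_pow, norm_sq_axialVec, norm_sq_axialVec]
  have h1 : a ^ 2 ≤ B ^ 2 * a' ^ 2 := by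
    rw [← sq_abs a, ← sq_abs a', ← mul_pow]; gcongr
  have h2 : b ^ 2 ≤ B ^ 2 * b' ^ 2 := by
    rw [← sq_abs b, ← sq_abs b', ← mul_pow]; gcongr
  have := mul_le_mul_of_nonneg_right h2 (axisSq_nonneg x)
  linarith

lemma measurable_axialVec {a b : EuclideanSpace ℝ (Fin (n + 1)) → ℝ} (ha : Measurable a)
    (hb : Measurable b) : Measurable fun x => axialVec (a x) (b x) x := by
  have : Measurable fun x : EuclideanSpace ℝ (Fin (n + 1)) =>
      (Fin.cons (a x) fun i => b x * x i.succ : Fin (n + 1) → ℝ) := by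
    refine measurable_pi_iff.2 fun i => ?_
    refine Fin.cases ?_ (fun i => ?_) i
    · simpa using ha
    · simp only [Fin.cons_succ]; fun_prop
  exact (WithLp.measurable_toLp 2 _).comp this

/-- The gradient of a function `e ^ (c z) h (r²)`. -/
lemma hasGradientAt_exp_mul (c : ℝ) {h : ℝ → ℝ} {h' : ℝ} {x : EuclideanSpace ℝ (Fin (n + 1))}
    (hh : HasDerivAt h h' (axisSq x)) :
    HasGradientAt (fun y : EuclideanSpace ℝ (Fin (n + 1)) => Real.exp (c * y 0) * h (axisSq y))
      (Real.exp (c * x 0) • axialVec (c * h (axisSq x)) (2 * h') x) x := by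
  rw [hasGradientAt_iff_hasFDerivAt]
  have h0 : HasFDerivAt (fun y : EuclideanSpace ℝ (Fin (n + 1)) => y 0)
      (EuclideanSpace.proj (𝕜 := ℝ) (0 : Fin (n + 1))) x :=
    (EuclideanSpace.proj (𝕜 := ℝ) (0 : Fin (n + 1))).hasFDerivAt
  have h1 : HasFDerivAt (axisSq (n := n)) (∑ i : Fin n, (2 * x i.succ) •
      (EuclideanSpace.proj i.succ : EuclideanSpace ℝ (Fin (n + 1)) →L[ℝ] ℝ)) x := by
    unfold axisSq
    refine HasFDerivAt.fun_sum fun i _ => ?_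
    have := (EuclideanSpace.proj i.succ : EuclideanSpace ℝ (Fin (n + 1)) →L[ℝ] ℝ).hasFDerivAt
      (x := x)
    simpa using this.pow 2
  have h2 := ((h0.const_mul c).exp).mul (hh.comp_hasFDerivAt x h1)
  convert! h2 using 1
  ext y
  rw [InnerProductSpace.toDual_apply_apply, real_inner_smul_left, PiLp.inner_apply,
    Fin.sum_univ_succ]
  simp only [axialVec_zero, axialVec_succ, add_apply,
    smul_apply, smul_eq_mul, Function.comp_apply,
    sum_apply, PiLp.proj_apply, RCLike.inner_apply, conj_trivial]
  rw [Finset.mul_sum, mul_add, Finset.mul_sum, Finset.mul_sum, add_comm]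
  congr 1
  · exact Finset.sum_congr rfl fun i _ => by ring
  · ring

namespace Profile

variable (P : Profile n p c)

/-- The subsolution. -/
def v (x : EuclideanSpace ℝ (Fin (n + 1))) : ℝ := Real.exp (c * x 0) * P.φ (axisSq x)

/-- The direction of the gradient of the subsolution. -/
def dir (x : EuclideanSpace ℝ (Fin (n + 1))) : EuclideanSpace ℝ (Fin (n + 1)) :=
  axialVec c (-P.k (axisSq x)) x

/-- The gradient of the subsolution (off the axis). -/
def grad (x : EuclideanSpace ℝ (Fin (n + 1))) : EuclideanSpace ℝ (Fin (n + 1)) :=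
  P.v x • P.dir x

/-- The weight for which the flux orthogonal to the axis is `-e ^ ((p - 1) c z) f (r²) x'`; the
value `1` on the axis is immaterial. -/
def weight (x : EuclideanSpace ℝ (Fin (n + 1))) : ℝ :=
  if axisSq x = 0 then 1 else
    P.f (axisSq x) / (P.k (axisSq x) * P.φ (axisSq x) ^ (p - 1) *
      (c ^ 2 + P.k (axisSq x) ^ 2 * axisSq x) ^ ((p - 2) / 2))

/-- The divergence of the flux. -/
def divFlux (x : EuclideanSpace ℝ (Fin (n + 1))) : ℝ :=
  P.f (axisSq x) * Real.exp ((p - 1) * c * x 0) *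
    ((p - 1) * c ^ 2 / P.k (axisSq x) - P.j (axisSq x))

lemma measurable_v : Measurable P.v := by
  have := P.measurable_φ
  unfold v; fun_prop

lemma measurable_grad : Measurable P.grad := by
  have := P.measurable_k
  exact P.measurable_v.smul (measurable_axialVec measurable_const (by fun_prop))

lemma measurable_weight : Measurable P.weight := by
  have h1 := P.measurable_k
  have h2 := P.measurable_f
  have h3 := P.measurable_φ
  exact Measurable.ite (measurableSet_eq_fun (by fun_prop) (by fun_prop)) measurable_const
    (by fun_prop)

lemma measurable_divFlux : Measurable P.divFlux := by
  have h1 := P.measurable_k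
  have h2 := P.measurable_f
  have h3 := P.measurable_j
  unfold divFlux; fun_prop

variable {P}

lemma φ_pos {R : ℝ} (h0 : 0 < R) (h1 : R < 1) : 0 < P.φ R :=
  one_pos.trans_le (P.one_le_φ R h0 h1)

lemma k_pos {R : ℝ} (h0 : 0 < R) : 0 < P.k R := one_pos.trans_le (P.one_le_k R h0)

lemma weight_pos {x : EuclideanSpace ℝ (Fin (n + 1))} (hx : x ∈ Metric.ball 0 1) :
    0 < P.weight x := by
  unfold weight
  split_ifs with h
  · exact one_pos
  · have h0 : 0 < axisSq x := lt_of_le_of_ne (axisSq_nonneg x) (Ne.symm h)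
    have := P.φ_pos h0 (axisSq_lt_one hx)
    have := P.k_pos h0
    have := P.f_pos _ h0
    positivity

lemma norm_dir_sq (x : EuclideanSpace ℝ (Fin (n + 1))) :
    ‖P.dir x‖ ^ 2 = c ^ 2 + P.k (axisSq x) ^ 2 * axisSq x := by
  rw [dir, norm_sq_axialVec, neg_sq]

lemma le_norm_dir (x : EuclideanSpace ℝ (Fin (n + 1))) : c ≤ ‖P.dir x‖ := by
  apply le_of_sq_le_sq _ (norm_nonneg _)
  rw [norm_dir_sq]
  have := axisSq_nonneg x
  nlinarith [mul_nonneg (sq_nonneg (P.k (axisSq x))) this]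

lemma v_pos {x : EuclideanSpace ℝ (Fin (n + 1))} (hx : x ∈ Metric.ball 0 1) (h0 : 0 < axisSq x) :
    0 < P.v x :=
  mul_pos (Real.exp_pos _) (P.φ_pos h0 (axisSq_lt_one hx))

/-- The identity defining the weight. -/
lemma weight_mul (hc : 1 ≤ c) {x : EuclideanSpace ℝ (Fin (n + 1))} (hx : x ∈ Metric.ball 0 1)
    (h0 : 0 < axisSq x) :
    P.weight x * ‖P.grad x‖ ^ (p - 2) * P.v x =
      Real.exp ((p - 1) * c * x 0) * (P.f (axisSq x) / P.k (axisSq x)) := by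
  have hφ := P.φ_pos h0 (axisSq_lt_one hx)
  have hk := P.k_pos h0
  have hv := P.v_pos hx h0
  have hd : 0 < ‖P.dir x‖ := by linarith [P.le_norm_dir x]
  have e1 : (c ^ 2 + P.k (axisSq x) ^ 2 * axisSq x) ^ ((p - 2) / 2) = ‖P.dir x‖ ^ (p - 2) := by
    rw [← norm_dir_sq, ← Real.rpow_natCast, ← Real.rpow_mul hd.le]
    congr 1; push_cast; ring
  have e2 : P.v x ^ (p - 2) * P.v x =
      Real.exp ((p - 1) * c * x 0) * P.φ (axisSq x) ^ (p - 1) := by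
    nth_rw 2 [← Real.rpow_one (P.v x)]
    rw [← Real.rpow_add hv, v, Real.mul_rpow (Real.exp_nonneg _) hφ.le, ← Real.exp_mul]
    congr 2 <;> ring
  rw [weight, if_neg h0.ne', e1, grad, norm_smul, Real.norm_eq_abs, abs_of_pos hv,
    Real.mul_rpow hv.le hd.le]
  have h1 : 0 < ‖P.dir x‖ ^ (p - 2) := by positivity
  have h2 : 0 < P.φ (axisSq x) ^ (p - 1) := by positivity
  calc _ = P.f (axisSq x) / (P.k (axisSq x) * P.φ (axisSq x) ^ (p - 1) * ‖P.dir x‖ ^ (p - 2)) *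
        (P.v x ^ (p - 2) * P.v x) * ‖P.dir x‖ ^ (p - 2) := by ring
    _ = _ := by rw [e2]; field_simp

lemma pLaplaceField_grad (hc : 1 ≤ c) {x : EuclideanSpace ℝ (Fin (n + 1))}
    (hx : x ∈ Metric.ball 0 1) (h0 : 0 < axisSq x) :
    pLaplaceField P.weight p x (P.grad x) =
      (Real.exp ((p - 1) * c * x 0) * (P.f (axisSq x) / P.k (axisSq x))) • P.dir x := by
  rw [pLaplaceField, ← weight_mul hc hx h0, mul_smul _ (P.v x)]
  rfl

lemma weight_mul_norm_grad_rpow (hc : 1 ≤ c) {x : EuclideanSpace ℝ (Fin (n + 1))}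
    (hx : x ∈ Metric.ball 0 1) (h0 : 0 < axisSq x) :
    P.weight x * ‖P.grad x‖ ^ (p - 1) =
      Real.exp ((p - 1) * c * x 0) * (P.f (axisSq x) / P.k (axisSq x)) * ‖P.dir x‖ := by
  have hv := P.v_pos hx h0
  have hd : 0 < ‖P.dir x‖ := by linarith [P.le_norm_dir x]
  have hg : ‖P.grad x‖ = P.v x * ‖P.dir x‖ := by
    rw [grad, norm_smul, Real.norm_eq_abs, abs_of_pos hv]
  have hg0 : 0 < ‖P.grad x‖ := by rw [hg]; positivity
  rw [← weight_mul hc hx h0, show p - 1 = (p - 2) + 1 by ring, Real.rpow_add hg0, Real.rpow_one]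
  nth_rw 2 [hg]
  ring

/-- The energy density is controlled by `φ f`. -/
lemma exists_energy_le (P : Profile n p c) (hc : 1 ≤ c) : ∃ C, 0 ≤ C ∧
    ∀ x ∈ Metric.ball 0 1, 0 < axisSq x →
      P.weight x * ‖P.grad x‖ ^ p ≤ C * (P.φ (axisSq x) * P.f (axisSq x)) := by
  have hK : 0 ≤ P.K := (mul_nonneg (abs_nonneg _) (P.k_pos (by norm_num)).le).trans
    (P.abs_j_mul_k_le (1 / 2) (by norm_num) (by norm_num))
  refine ⟨Real.exp |p * c| * (c ^ 2 + P.K), by positivity, fun x hx h0 => ?_⟩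
  have hv := P.v_pos hx h0
  have hφ := P.φ_pos h0 (axisSq_lt_one hx)
  have hk := P.k_pos h0
  have hf := P.f_pos _ h0
  have hd : 0 < ‖P.dir x‖ := by linarith [P.le_norm_dir x]
  have hg : ‖P.grad x‖ = P.v x * ‖P.dir x‖ := by
    rw [grad, norm_smul, Real.norm_eq_abs, abs_of_pos hv]
  have hg0 : 0 < ‖P.grad x‖ := by rw [hg]; positivity
  have e : P.weight x * ‖P.grad x‖ ^ p = Real.exp (p * c * x 0) *
      (P.φ (axisSq x) * P.f (axisSq x) * (‖P.dir x‖ ^ 2 / P.k (axisSq x))) := by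
    have e1 : ‖P.grad x‖ ^ p = ‖P.grad x‖ ^ (p - 1) * ‖P.grad x‖ := by
      rw [← Real.rpow_add_one hg0.ne', sub_add_cancel]
    rw [e1, ← mul_assoc, weight_mul_norm_grad_rpow hc hx h0, hg, v,
      show p * c * x 0 = (p - 1) * c * x 0 + c * x 0 by ring, Real.exp_add]
    ring
  have h1 : ‖P.dir x‖ ^ 2 / P.k (axisSq x) ≤ c ^ 2 + P.K := by
    rw [norm_dir_sq, add_div]
    gcongr
    · exact div_le_self (by positivity) (P.one_le_k _ h0)
    · calc P.k (axisSq x) ^ 2 * axisSq x / P.k (axisSq x) = P.k (axisSq x) * axisSq x := by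
            field_simp
        _ ≤ _ := P.k_mul_le _ h0 (axisSq_lt_one hx)
  rw [e]
  calc _ ≤ Real.exp |p * c| * (P.φ (axisSq x) * P.f (axisSq x) * (c ^ 2 + P.K)) := by
        gcongr
        exact mul_apply_zero_le_abs hx _
    _ = _ := by ring

lemma abs_v_le_norm_grad (hc : 1 ≤ c) (x : EuclideanSpace ℝ (Fin (n + 1))) :
    |P.v x| ≤ ‖P.grad x‖ := by
  rw [grad, norm_smul, Real.norm_eq_abs]
  exact le_mul_of_one_le_right (abs_nonneg _) (hc.trans (P.le_norm_dir x))

lemma lintegral_energy_lt_top (hn : n ≠ 0) (hp : 1 < p) (hc : 1 ≤ c) :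
    ∫⁻ x in Metric.ball 0 1, ENNReal.ofReal (P.weight x) * ‖P.grad x‖ₑ ^ p < ∞ := by
  obtain ⟨C, hC0, hC⟩ := P.exists_energy_le hc
  have h := (P.integrableOn.const_mul C).2
  refine lt_of_le_of_lt (lintegral_mono_ae ?_) h
  filter_upwards [ae_axisSq_pos hn] with x hx
  have hw := P.weight_pos hx.1
  rw [← ofReal_norm, ENNReal.ofReal_rpow_of_nonneg (norm_nonneg _) (by linarith),
    ← ENNReal.ofReal_mul hw.le, ← ofReal_norm]
  exact ENNReal.ofReal_le_ofReal ((hC x hx.1 hx.2).trans (le_abs_self _))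

end Profile

/-! ### The subsolution inequality and unboundedness -/

lemma fderiv_apply_eq_sum (ψ : EuclideanSpace ℝ (Fin (n + 1)) → ℝ)
    (x y : EuclideanSpace ℝ (Fin (n + 1))) :
    fderiv ℝ ψ x y = ∑ i, y i * partialDeriv i ψ x := by
  have h : y = ∑ i, y i • EuclideanSpace.single i (1 : ℝ) := by
    ext k
    simp [Pi.single_apply]
  conv_lhs => rw [h]
  simp [partialDeriv]

namespace Profile

variable {P : Profile n p c}

lemma integrableOn_f (hn : n ≠ 0) :
    IntegrableOn (fun x : EuclideanSpace ℝ (Fin (n + 1)) => P.f (axisSq x))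
      (Metric.ball 0 1) := by
  have hm : Measurable fun x : EuclideanSpace ℝ (Fin (n + 1)) => P.f (axisSq x) :=
    P.measurable_f.comp measurable_axisSq
  refine Integrable.mono P.integrableOn hm.aestronglyMeasurable ?_
  filter_upwards [ae_axisSq_pos hn] with x hx
  have h1 := P.one_le_φ _ hx.2 (axisSq_lt_one hx.1)
  rw [norm_mul, Real.norm_of_nonneg (by linarith : 0 ≤ P.φ (axisSq x))]
  exact le_mul_of_one_le_left (norm_nonneg _) h1

/-- The divergence of the flux is computed against test functions. -/
lemma integral_flux (P : Profile n p c) (hn : n ≠ 0) (hc : 1 ≤ c)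
    {ψ : EuclideanSpace ℝ (Fin (n + 1)) → ℝ} (hψ : IsTest ψ) :
    ∫ x in Metric.ball 0 1, inner ℝ (pLaplaceField P.weight p x (P.grad x)) (gradient ψ x) =
      -∫ x in Metric.ball 0 1, inner ℝ (P.divFlux x) (ψ x) := by
  have hk := P.measurable_k
  have hf := P.measurable_f
  have hfint := P.integrableOn_f hn
  set a := (p - 1) * c with ha
  have hq : Measurable fun R => c * (P.f R / P.k R) := by fun_prop
  have hqint : IntegrableOn (fun x : EuclideanSpace ℝ (Fin (n + 1)) =>
      c * (P.f (axisSq x) / P.k (axisSq x))) (Metric.ball 0 1) := by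
    apply Integrable.const_mul
    refine Integrable.mono hfint ?_ ?_
    · exact Measurable.aestronglyMeasurable (by fun_prop)
    · filter_upwards [ae_axisSq_pos hn] with x hx
      rw [norm_div, Real.norm_eq_abs (P.k _)]
      exact div_le_self (norm_nonneg _) ((P.one_le_k _ hx.2).trans (le_abs_self _))
  obtain ⟨hz1, hz2, hz3⟩ := integral_mul_partialDeriv_zero hq hqint a hψ
  have hJ : ∀ R, 0 < R → R < 1 → |P.j R| ≤ P.K := fun R h0 h1 =>
    (le_mul_of_one_le_right (abs_nonneg _) (P.one_le_k R h0)).trans (P.abs_j_mul_k_le R h0 h1)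
  have hx := integral_mul_partialDeriv_succ hn P.measurable_f P.measurable_j hfint P.hasDerivAt_f
    hJ a hψ
  have hae : ∀ᵐ x : EuclideanSpace ℝ (Fin (n + 1)), x ∈ Metric.ball 0 1 → 0 < axisSq x := by
    have := ae_axisSq_pos hn
    rw [ae_restrict_iff' measurableSet_ball] at this
    filter_upwards [this] with x hx hx' using (hx hx').2
  rw [setIntegral_eq_integral_of_forall_compl_eq_zero,
    setIntegral_eq_integral_of_forall_compl_eq_zero]
  · calc _ = ∫ x, ((c * (P.f (axisSq x) / P.k (axisSq x))) * Real.exp (a * x 0) *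
          partialDeriv 0 ψ x - ∑ i : Fin n, P.f (axisSq x) * Real.exp (a * x 0) * x i.succ *
            partialDeriv i.succ ψ x) := by
          refine integral_congr_ae ?_
          filter_upwards [hae] with x hx
          rw [inner_gradient_right, conj_trivial]
          by_cases hxb : x ∈ Metric.ball (0 : EuclideanSpace ℝ (Fin (n + 1))) 1
          · rw [pLaplaceField_grad hc hxb (hx hxb), fderiv_apply_eq_sum, Fin.sum_univ_succ]
            have := P.k_pos (hx hxb)
            refine (congrArg₂ (· + ·) ?_ ?_).trans (sub_eq_add_neg _ _).symm
            · simp only [dir, PiLp.smul_apply, axialVec_zero, smul_eq_mul]; ring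
            · rw [← Finset.sum_neg_distrib]
              refine Finset.sum_congr rfl fun i _ => ?_
              simp only [dir, PiLp.smul_apply, axialVec_succ, smul_eq_mul, ha]; field_simp
          · simp [hψ.fderiv_eq_zero hxb, hψ.partialDeriv_eq_zero _ hxb]
      _ = -∫ x, (a * ((c * (P.f (axisSq x) / P.k (axisSq x))) * Real.exp (a * x 0)) * ψ x -
          ∑ i : Fin n, P.f (axisSq x) * Real.exp (a * x 0) *
            (1 + (P.j (axisSq x) - n) * x i.succ ^ 2 / axisSq x) * ψ x) := by
          rw [integral_sub hz1 (integrable_finsetSum _ fun i _ => (hx i).1),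
            integral_sub hz2 (integrable_finsetSum _ fun i _ => (hx i).2.1),
            integral_finsetSum _ fun i _ => (hx i).1,
            integral_finsetSum _ fun i _ => (hx i).2.1, hz3,
            Finset.sum_congr rfl fun i _ => (hx i).2.2, Finset.sum_neg_distrib]
          ring
      _ = _ := by
          congr 1
          refine integral_congr_ae ?_
          filter_upwards [hae] with x hx
          by_cases hxb : x ∈ Metric.ball (0 : EuclideanSpace ℝ (Fin (n + 1))) 1
          · have h0 := hx hxb
            have hk := P.k_pos h0
            rw [← Finset.sum_mul, ← Finset.mul_sum, Finset.sum_add_distrib, ← Finset.sum_div,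
              ← Finset.mul_sum]
            simp only [Finset.sum_const, Finset.card_univ, Fintype.card_fin, nsmul_eq_mul, mul_one]
            rw [show ∑ i : Fin n, x i.succ ^ 2 = axisSq x from rfl,
              mul_div_assoc _ (axisSq x), div_self h0.ne', divFlux, real_inner_eq_re_inner]
            simp only [RCLike.inner_apply, conj_trivial, RCLike.re_to_real, ha]
            field_simp
            ring
          · simp [hψ.eq_zero hxb]
  · intro x hx
    simp [hψ.eq_zero hx]
  · intro x hx
    rw [inner_gradient_right, hψ.fderiv_eq_zero hx]
    simp

lemma divFlux_nonneg {x : EuclideanSpace ℝ (Fin (n + 1))} (hx : x ∈ Metric.ball 0 1)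
    (h0 : 0 < axisSq x) : 0 ≤ P.divFlux x := by
  have hk := P.k_pos h0
  have hf := P.f_pos _ h0
  have : P.j (axisSq x) ≤ (p - 1) * c ^ 2 / P.k (axisSq x) := by
    rw [le_div_iff₀ hk]; exact P.j_mul_k_le _ h0 (axisSq_lt_one hx)
  unfold divFlux
  have := sub_nonneg.2 this
  positivity

lemma exists_divFlux_le (P : Profile n p c) (hp : 1 < p) (hc : 1 ≤ c) : ∃ C, 0 ≤ C ∧
    ∀ x ∈ Metric.ball 0 1, 0 < axisSq x →
      |P.divFlux x| ≤ C * (P.weight x * ‖P.grad x‖ ^ (p - 1)) := by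
  have hK : 0 ≤ P.K := (mul_nonneg (abs_nonneg _) (P.k_pos (by norm_num)).le).trans
    (P.abs_j_mul_k_le (1 / 2) (by norm_num) (by norm_num))
  have hp1 : 0 < p - 1 := by linarith
  refine ⟨(p - 1) * c ^ 2 + P.K, by positivity, fun x hx h0 => ?_⟩
  have hk := P.k_pos h0
  have hf := P.f_pos _ h0
  have hd : 1 ≤ ‖P.dir x‖ := hc.trans (P.le_norm_dir x)
  rw [weight_mul_norm_grad_rpow hc hx h0, divFlux, abs_mul, abs_of_pos (by positivity)]
  have h1 : |(p - 1) * c ^ 2 / P.k (axisSq x) - P.j (axisSq x)| ≤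
      ((p - 1) * c ^ 2 + P.K) / P.k (axisSq x) := by
    rw [le_div_iff₀ hk]
    calc _ = |(p - 1) * c ^ 2 - P.j (axisSq x) * P.k (axisSq x)| := by
          nth_rw 2 [← abs_of_pos hk]
          rw [← abs_mul, sub_mul, div_mul_cancel₀ _ hk.ne']
      _ ≤ |(p - 1) * c ^ 2| + |P.j (axisSq x) * P.k (axisSq x)| := abs_sub _ _
      _ ≤ _ := by
          rw [abs_of_nonneg (by positivity : 0 ≤ (p - 1) * c ^ 2), abs_mul, abs_of_pos hk]
          gcongr
          exact P.abs_j_mul_k_le _ h0 (axisSq_lt_one hx)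
  calc _ ≤ P.f (axisSq x) * Real.exp ((p - 1) * c * x 0) *
        (((p - 1) * c ^ 2 + P.K) / P.k (axisSq x)) := by gcongr
    _ = ((p - 1) * c ^ 2 + P.K) * (Real.exp ((p - 1) * c * x 0) *
        (P.f (axisSq x) / P.k (axisSq x))) := by ring
    _ ≤ ((p - 1) * c ^ 2 + P.K) * (Real.exp ((p - 1) * c * x 0) *
        (P.f (axisSq x) / P.k (axisSq x)) * ‖P.dir x‖) :=
        mul_le_mul_of_nonneg_left (le_mul_of_one_le_right (by positivity) hd) (by positivity)

/-- The subsolution inequality extends from smooth test functions to the whole space `H₀`. The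
approximating test functions need not be nonnegative, as both sides of the identity `integral_flux`
pass to the limit. -/
lemma subsolution_inequality (P : Profile n p c) (hn : n ≠ 0) (hp : 1 < p) (hc : 1 ≤ c)
    {φ : EuclideanSpace ℝ (Fin (n + 1)) → ℝ}
    {Φ : EuclideanSpace ℝ (Fin (n + 1)) → EuclideanSpace ℝ (Fin (n + 1))}
    (hφ : MemH₀ (Metric.ball 0 1) (pLaplaceField P.weight p) p φ Φ)
    (hpos : ∀ᵐ x ∂(volume.restrict (Metric.ball 0 1)), 0 ≤ φ x) :
    IntegrableOn (fun x => inner ℝ (pLaplaceField P.weight p x (P.grad x)) (Φ x))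
      (Metric.ball 0 1) ∧
    ∫ x in Metric.ball 0 1, inner ℝ (pLaplaceField P.weight p x (P.grad x)) (Φ x) ≤ 0 := by
  obtain ⟨hφm, hΦm, ψ, hψ, hlim⟩ := hφ
  have hp0 : 0 < p := by linarith
  have hw : ∀ x ∈ Metric.ball 0 1, 0 < P.weight x := fun x hx => P.weight_pos hx
  have hψt : ∀ m, IsTest (ψ m) := fun m => ⟨(hψ m).1.1, (hψ m).1.2.1, (hψ m).1.2.2⟩
  have hWm := P.measurable_weight
  have hGm := P.measurable_grad
  have hW : AEMeasurable (fun x => ENNReal.ofReal (P.weight x))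
      (volume.restrict (Metric.ball 0 1)) := by fun_prop
  have hg : AEMeasurable (fun x => ‖P.grad x‖ₑ) (volume.restrict (Metric.ball 0 1)) := by fun_prop
  have hgradm : ∀ m, AEStronglyMeasurable (gradient (ψ m))
      (volume.restrict (Metric.ball 0 1)) := fun m =>
    ((InnerProductSpace.toDual ℝ _).symm.continuous.comp
      ((hψt m).contDiff.continuous_fderiv one_ne_zero)).aestronglyMeasurable
  have hψm : ∀ m, AEStronglyMeasurable (ψ m) (volume.restrict (Metric.ball 0 1)) := fun m =>
    (hψt m).contDiff.continuous.aestronglyMeasurable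
  have hE := P.lintegral_energy_lt_top hn hp hc
  have hen := energyNorm_pLaplaceField n.succ_ne_zero p measurableSet_ball hw
  have hfin : ∀ m, ∫⁻ x in Metric.ball 0 1, (ENNReal.ofReal (P.weight x) * ‖gradient (ψ m) x‖ₑ ^ p +
      ENNReal.ofReal (P.weight x) * ‖ψ m x‖ₑ ^ p) ≠ ∞ := by
    intro m
    have := (hψ m).2
    rw [hen, ENNReal.rpow_lt_top_iff_of_pos (by positivity)] at this
    exact this.ne
  have hlim' : Tendsto (fun m => ∫⁻ x in Metric.ball 0 1,
      (ENNReal.ofReal (P.weight x) * ‖gradient (ψ m) x - Φ x‖ₑ ^ p +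
      ENNReal.ofReal (P.weight x) * ‖ψ m x - φ x‖ₑ ^ p)) atTop (𝓝 0) := by
    simp only [hen] at hlim
    have := hlim.ennrpow_const p
    simpa [← ENNReal.rpow_mul, hp0, hp0.ne'] using this
  have hflux : Measurable fun x => pLaplaceField P.weight p x (P.grad x) := by
    unfold pLaplaceField; fun_prop
  have hnormrpow : ∀ x, ‖P.grad x‖ₑ ^ (p - 1) = ENNReal.ofReal (‖P.grad x‖ ^ (p - 1)) := fun x => by
    rw [← ofReal_norm, ENNReal.ofReal_rpow_of_nonneg (norm_nonneg _) (by linarith)]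
  have hT1 := tendsto_integral_inner_of_weighted hp hW hg
    (Y := fun x => pLaplaceField P.weight p x (P.grad x)) (Z := Φ)
    (Zn := fun m => gradient (ψ m)) hflux.aestronglyMeasurable hΦm hgradm (A := 1)
    ENNReal.one_ne_top (by
      filter_upwards [ae_axisSq_pos hn] with x hx
      have hG : P.grad x ≠ 0 := by
        have h1 := P.v_pos hx.1 hx.2
        have h2 := P.le_norm_dir x
        refine smul_ne_zero h1.ne' (norm_pos_iff.1 (by linarith))
      rw [one_mul, hnormrpow, ← ENNReal.ofReal_mul (hw x hx.1).le, ← ofReal_norm,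
        norm_pLaplaceField p (hw x hx.1) hG]) hE.ne
    (fun m => ne_top_of_le_ne_top (hfin m) (lintegral_mono fun x => le_self_add))
    (tendsto_of_tendsto_of_tendsto_of_le_of_le tendsto_const_nhds hlim' (fun _ => zero_le)
      fun m => lintegral_mono fun x => le_self_add)
  obtain ⟨C, hC0, hC⟩ := P.exists_divFlux_le hp hc
  have hT2 := tendsto_integral_inner_of_weighted hp hW hg
    (Y := P.divFlux) (Z := φ) (Zn := ψ) P.measurable_divFlux.aestronglyMeasurable hφm hψm
    (A := ENNReal.ofReal C) ENNReal.ofReal_ne_top (by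
      filter_upwards [ae_axisSq_pos hn] with x hx
      rw [hnormrpow, ← ENNReal.ofReal_mul (hw x hx.1).le, ← ofReal_norm,
        ← ENNReal.ofReal_mul hC0]
      exact ENNReal.ofReal_le_ofReal (hC x hx.1 hx.2)) hE.ne
    (fun m => ne_top_of_le_ne_top (hfin m) (lintegral_mono fun x => le_add_self))
    (tendsto_of_tendsto_of_tendsto_of_le_of_le tendsto_const_nhds hlim' (fun _ => zero_le)
      fun m => lintegral_mono fun x => le_add_self)
  refine ⟨hT1.1, ?_⟩
  have heq : ∫ x in Metric.ball 0 1, inner ℝ (pLaplaceField P.weight p x (P.grad x)) (Φ x) =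
      -∫ x in Metric.ball 0 1, inner ℝ (P.divFlux x) (φ x) := by
    refine tendsto_nhds_unique hT1.2 ?_
    simp only [P.integral_flux hn hc (hψt _)]
    exact hT2.2.neg
  rw [heq, neg_nonpos]
  refine integral_nonneg_of_ae ?_
  filter_upwards [ae_axisSq_pos hn, hpos] with x hx hφx
  simpa using mul_nonneg hφx (divFlux_nonneg hx.1 hx.2)

lemma not_locallyBoundedAbove (P : Profile n p c) (hn : n ≠ 0) :
    ¬ LocallyBoundedAbove (Metric.ball 0 1) P.v := by
  intro h
  obtain ⟨M, hM⟩ := h (Metric.closedBall 0 (1 / 2)) (isCompact_closedBall _ _)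
    (Metric.closedBall_subset_ball (by norm_num))
  have hev := P.tendsto_φ.eventually (eventually_gt_atTop (|M| * Real.exp |c|))
  obtain ⟨δ, hδ, hδM⟩ := (mem_nhdsGT_iff_exists_Ioo_subset).1 hev
  have hδ0 : (0 : ℝ) < δ := hδ
  -- an open set touching the axis on which `v > M`
  set U : Set (EuclideanSpace ℝ (Fin (n + 1))) :=
    Metric.ball 0 (1 / 2) ∩ ({x | axisSq x < δ} ∩ {x | 0 < axisSq x}) with hU
  have hUo : IsOpen U := Metric.isOpen_ball.inter
    ((isOpen_lt continuous_axisSq continuous_const).inter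
      (isOpen_lt continuous_const continuous_axisSq))
  have hUne : U.Nonempty := by
    obtain ⟨ε, hε0, hε⟩ : ∃ ε : ℝ, 0 < ε ∧ ε < min (1 / 2) δ := exists_between (by positivity)
    have h1 := hε.trans_le (min_le_left _ _)
    have h2 := hε.trans_le (min_le_right _ _)
    obtain ⟨i₀⟩ : Nonempty (Fin n) := ⟨⟨0, Nat.pos_of_ne_zero hn⟩⟩
    have hax : axisSq (EuclideanSpace.single i₀.succ ε) = ε ^ 2 := by
      rw [axisSq, Finset.sum_eq_single i₀]
      · simp
      · intro i _ hi; simp [hi]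
      · simp
    refine ⟨EuclideanSpace.single i₀.succ ε, ?_, (?_ : axisSq _ < δ), (?_ : 0 < axisSq _)⟩
    · simpa [abs_of_pos hε0] using h1
    · rw [hax]; nlinarith
    · rw [hax]; positivity
  refine (hUo.measure_pos volume hUne).ne' ?_
  rw [ae_restrict_iff' Metric.isClosed_closedBall.measurableSet, ae_iff] at hM
  refine measure_mono_null ?_ hM
  rintro x ⟨hx, hxδ, hx0⟩ hle
  have hxδ' : axisSq x < δ := hxδ
  have hx0' : 0 < axisSq x := hx0
  have hxb : x ∈ Metric.ball (0 : EuclideanSpace ℝ (Fin (n + 1))) 1 :=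
    Metric.ball_subset_ball (by norm_num) hx
  have h1 : |M| * Real.exp |c| < P.φ (axisSq x) := hδM ⟨hx0', hxδ'⟩
  have h2 := hle (Metric.ball_subset_closedBall hx)
  have h3 : -|c| ≤ c * x 0 := by
    have := mul_apply_zero_le_abs hxb (-c)
    rw [abs_neg] at this
    linarith
  have h4 : Real.exp (-|c|) * (|M| * Real.exp |c|) < P.v x :=
    mul_lt_mul_of_le_of_lt_of_pos_of_nonneg (Real.exp_le_exp.2 h3) h1 (Real.exp_pos _)
      ((by positivity : 0 ≤ |M| * Real.exp |c|).trans h1.le)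
  rw [mul_left_comm, ← Real.exp_add, neg_add_cancel, Real.exp_zero, mul_one] at h4
  linarith [le_abs_self M]

end Profile

/-! ### Truncation: the subsolution belongs to the energy space -/

/-- A smooth truncation at height `m`: the identity on `(-∞, m]`, and constant on `[m + 1, ∞)`. -/
def trunc (m y : ℝ) : ℝ := m + (y - m) * (1 - Real.smoothTransition (y - m))

/-- The derivative of `trunc m`. -/
def truncDeriv (m y : ℝ) : ℝ :=
  1 - Real.smoothTransition (y - m) - (y - m) * deriv Real.smoothTransition (y - m)

lemma contDiff_trunc (m : ℝ) : ContDiff ℝ 1 (trunc m) := by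
  have := Real.smoothTransition.contDiff (n := 1)
  unfold trunc
  exact contDiff_const.add ((contDiff_id.sub contDiff_const).mul
    (contDiff_const.sub (this.comp (contDiff_id.sub contDiff_const))))

lemma hasDerivAt_trunc (m y : ℝ) : HasDerivAt (trunc m) (truncDeriv m y) y := by
  have h1 : HasDerivAt (fun y : ℝ => y - m) 1 y := (hasDerivAt_id y).sub_const m
  have h2 := (hasDerivAt_smoothTransition (y - m)).comp y h1
  have h3 := (h1.mul (h2.const_sub 1)).const_add m
  convert! h3 using 1
  simp only [truncDeriv, Function.comp_apply]; ring

lemma trunc_of_le {m y : ℝ} (h : y ≤ m) : trunc m y = y := by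
  simp [trunc, Real.smoothTransition.zero_of_nonpos (sub_nonpos.2 h)]

lemma trunc_of_ge {m y : ℝ} (h : m + 1 ≤ y) : trunc m y = m := by
  simp [trunc, Real.smoothTransition.one_of_one_le (by linarith : 1 ≤ y - m)]

lemma truncDeriv_of_le {m y : ℝ} (h : y ≤ m) : truncDeriv m y = 1 := by
  simp [truncDeriv, Real.smoothTransition.zero_of_nonpos (sub_nonpos.2 h),
    deriv_smoothTransition_of_nonpos (sub_nonpos.2 h)]

lemma abs_trunc_sub_le {m y : ℝ} (hm : 0 ≤ m) (hy : 0 ≤ y) : |trunc m y - y| ≤ y := by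
  rcases le_total y m with h | h
  · simpa [trunc_of_le h] using hy
  · have h1 := Real.smoothTransition.le_one (y - m)
    have h2 := Real.smoothTransition.nonneg (y - m)
    have e : trunc m y - y = -((y - m) * Real.smoothTransition (y - m)) := by
      unfold trunc; ring
    rw [e, abs_neg, abs_of_nonneg (mul_nonneg (by linarith) h2)]
    nlinarith

lemma exists_abs_truncDeriv_sub_one_le : ∃ B, 1 ≤ B ∧ ∀ m y, |truncDeriv m y - 1| ≤ B := by
  obtain ⟨S, hS0, hS⟩ := exists_deriv_smoothTransition_le
  refine ⟨1 + S, by linarith, fun m y => ?_⟩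
  have h1 := Real.smoothTransition.le_one (y - m)
  have h2 := Real.smoothTransition.nonneg (y - m)
  have e : truncDeriv m y - 1 = -(Real.smoothTransition (y - m) +
      (y - m) * deriv Real.smoothTransition (y - m)) := by unfold truncDeriv; ring
  rw [e, abs_neg]
  refine (abs_add_le _ _).trans (add_le_add (by rwa [abs_of_nonneg h2]) ?_)
  rcases le_total (y - m) 0 with h | h
  · simp [deriv_smoothTransition_of_nonpos h, hS0]
  rcases le_total 1 (y - m) with h' | h'
  · simp [deriv_smoothTransition_of_one_le h', hS0]
  · rw [abs_mul, abs_of_nonneg h]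
    calc _ ≤ 1 * S := by gcongr; exact hS _
      _ = S := one_mul S

namespace Profile

/-- The truncation of the radial factor `φ`, extended by its constant value near the axis. -/
def truncφ (P : Profile n p c) (m R : ℝ) : ℝ := if R ≤ 0 then m else trunc m (P.φ R)

lemma truncφ_of_pos (P : Profile n p c) (m : ℝ) {R : ℝ} (hR : 0 < R) :
    P.truncφ m R = trunc m (P.φ R) := if_neg (not_le.2 hR)

lemma truncφ_eventuallyEq (P : Profile n p c) (m : ℝ) {R : ℝ} (hR : 0 < R) :
    P.truncφ m =ᶠ[𝓝 R] fun R => trunc m (P.φ R) := by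
  filter_upwards [lt_mem_nhds hR] with y hy using P.truncφ_of_pos m hy

lemma contDiff_truncφ (P : Profile n p c) (m : ℝ) : ContDiff ℝ 1 (P.truncφ m) := by
  rw [contDiff_iff_contDiffAt]
  intro R
  rcases lt_or_ge 0 R with hR | hR
  · exact (((contDiff_trunc m).contDiffAt).comp R (P.contDiffAt_φ R hR)).congr_of_eventuallyEq
      (P.truncφ_eventuallyEq m hR)
  · have hev := P.tendsto_φ.eventually (eventually_ge_atTop (m + 1))
    obtain ⟨δ, hδ, hδm⟩ := (mem_nhdsGT_iff_exists_Ioo_subset).1 hev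
    have hδ0 : (0 : ℝ) < δ := hδ
    refine (contDiffAt_const (c := m)).congr_of_eventuallyEq ?_
    filter_upwards [gt_mem_nhds (lt_of_le_of_lt hR hδ0)] with y hy
    unfold truncφ
    split_ifs with h
    · rfl
    · exact trunc_of_ge (hδm ⟨not_le.1 h, hy⟩)

lemma hasDerivAt_truncφ (P : Profile n p c) (m : ℝ) {R : ℝ} (hR : 0 < R) :
    HasDerivAt (P.truncφ m) (truncDeriv m (P.φ R) * (-(P.φ R * P.k R) / 2)) R :=
  ((hasDerivAt_trunc m (P.φ R)).comp R (P.hasDerivAt_φ R hR)).congr_of_eventuallyEq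
    (P.truncφ_eventuallyEq m hR)

/-- The truncated subsolutions. -/
def truncV (P : Profile n p c) (m : ℝ) (x : EuclideanSpace ℝ (Fin (n + 1))) : ℝ :=
  Real.exp (c * x 0) * P.truncφ m (axisSq x)

lemma contDiff_truncV (P : Profile n p c) (m : ℝ) : ContDiff ℝ 1 (P.truncV m) := by
  have h1 := (P.contDiff_truncφ m).comp (contDiff_axisSq (n := n))
  have h2 : ContDiff ℝ 1 fun x : EuclideanSpace ℝ (Fin (n + 1)) => Real.exp (c * x 0) := by fun_prop
  exact h2.mul h1

lemma gradient_truncV_sub (P : Profile n p c) (m : ℝ) {x : EuclideanSpace ℝ (Fin (n + 1))}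
    (h0 : 0 < axisSq x) :
    gradient (P.truncV m) x - P.grad x = Real.exp (c * x 0) •
      axialVec (c * (trunc m (P.φ (axisSq x)) - P.φ (axisSq x)))
        (-((truncDeriv m (P.φ (axisSq x)) - 1) * (P.φ (axisSq x) * P.k (axisSq x)))) x := by
  rw [show gradient (P.truncV m) x = _ from
    (hasGradientAt_exp_mul c (P.hasDerivAt_truncφ m h0)).gradient, P.truncφ_of_pos m h0,
    grad, v, dir, mul_smul, ← smul_sub, smul_axialVec, axialVec_sub]
  congr 2 <;> ring

/-- The truncated subsolutions converge in energy. -/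
lemma memH (P : Profile n p c) (hn : n ≠ 0) (hp : 1 < p) (hc : 1 ≤ c) :
    MemH (Metric.ball 0 1) (pLaplaceField P.weight p) p P.v P.grad := by
  obtain ⟨B, hB1, hB⟩ := exists_abs_truncDeriv_sub_one_le
  have hp0 : 0 < p := by linarith
  have hw : ∀ x ∈ Metric.ball 0 1, 0 < P.weight x := fun x hx => P.weight_pos hx
  have hen := energyNorm_pLaplaceField n.succ_ne_zero p measurableSet_ball hw
  have hWm := P.measurable_weight
  have hGm := P.measurable_grad
  have hvm := P.measurable_v
  have hE := P.lintegral_energy_lt_top hn hp hc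
  have hfm : ∀ m : ℕ, Measurable (P.truncV m) := fun m =>
    (P.contDiff_truncV m).continuous.measurable
  have hgm : ∀ m : ℕ, Measurable (gradient (P.truncV m)) := fun m =>
    ((InnerProductSpace.toDual ℝ _).symm.continuous.comp
      ((P.contDiff_truncV m).continuous_fderiv one_ne_zero)).measurable
  have hdv : ∀ (m : ℕ), ∀ x ∈ Metric.ball (0 : EuclideanSpace ℝ (Fin (n + 1))) 1, 0 < axisSq x →
      ‖P.truncV m x - P.v x‖ ≤ B * ‖P.grad x‖ := by
    intro m x hx h0
    have hφ := P.φ_pos h0 (axisSq_lt_one hx)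
    rw [truncV, v, P.truncφ_of_pos m h0, ← mul_sub, Real.norm_eq_abs, abs_mul, Real.abs_exp]
    calc _ ≤ Real.exp (c * x 0) * P.φ (axisSq x) := by
          gcongr; exact abs_trunc_sub_le m.cast_nonneg hφ.le
      _ ≤ |P.v x| := le_abs_self _
      _ ≤ ‖P.grad x‖ := P.abs_v_le_norm_grad hc x
      _ ≤ B * ‖P.grad x‖ := le_mul_of_one_le_left (norm_nonneg _) hB1
  have hdg : ∀ (m : ℕ), ∀ x ∈ Metric.ball (0 : EuclideanSpace ℝ (Fin (n + 1))) 1, 0 < axisSq x →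
      ‖gradient (P.truncV m) x - P.grad x‖ ≤ B * ‖P.grad x‖ := by
    intro m x hx h0
    have hφ := P.φ_pos h0 (axisSq_lt_one hx)
    rw [gradient_truncV_sub P m h0, grad, v, dir, mul_smul, norm_smul, norm_smul _ (_ • _),
      mul_left_comm B]
    refine mul_le_mul_of_nonneg_left ?_ (norm_nonneg _)
    rw [smul_axialVec]
    apply norm_axialVec_le (by linarith)
    · rw [abs_mul, abs_mul, mul_comm |c|, abs_of_pos hφ, ← mul_assoc]
      gcongr
      exact (abs_trunc_sub_le m.cast_nonneg hφ.le).trans (le_mul_of_one_le_left hφ.le hB1)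
    · rw [abs_neg, abs_mul, mul_neg, abs_neg]
      gcongr
      exact hB _ _
  -- the dominating function
  set D : EuclideanSpace ℝ (Fin (n + 1)) → ℝ≥0∞ := fun x =>
    2 * ENNReal.ofReal (2 * B) ^ p * (ENNReal.ofReal (P.weight x) * ‖P.grad x‖ₑ ^ p) with hD
  have hDfin : ∫⁻ x in Metric.ball 0 1, D x ≠ ∞ := by
    have hC : 2 * ENNReal.ofReal (2 * B) ^ p ≠ ∞ :=
      ENNReal.mul_ne_top (by norm_num) (ENNReal.rpow_ne_top_of_nonneg hp0.le ENNReal.ofReal_ne_top)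
    rw [lintegral_const_mul' _ _ hC]
    exact ENNReal.mul_ne_top hC hE.ne
  have hbound : ∀ (x : EuclideanSpace ℝ (Fin (n + 1))) (a : EuclideanSpace ℝ (Fin (n + 1))) (b : ℝ),
      ‖a‖ ≤ 2 * B * ‖P.grad x‖ → ‖b‖ ≤ 2 * B * ‖P.grad x‖ →
      ENNReal.ofReal (P.weight x) * ‖a‖ₑ ^ p + ENNReal.ofReal (P.weight x) * ‖b‖ₑ ^ p ≤ D x := by
    intro x a b ha hb
    have h1 : ‖a‖ₑ ^ p ≤ ENNReal.ofReal (2 * B) ^ p * ‖P.grad x‖ₑ ^ p := by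
      rw [← ENNReal.mul_rpow_of_nonneg _ _ hp0.le, ← ofReal_norm, ← ofReal_norm,
        ← ENNReal.ofReal_mul (by linarith)]
      gcongr
    have h2 : ‖b‖ₑ ^ p ≤ ENNReal.ofReal (2 * B) ^ p * ‖P.grad x‖ₑ ^ p := by
      rw [← ENNReal.mul_rpow_of_nonneg _ _ hp0.le, ← ofReal_norm, ← ofReal_norm,
        ← ENNReal.ofReal_mul (by linarith)]
      gcongr
    calc _ ≤ ENNReal.ofReal (P.weight x) * (ENNReal.ofReal (2 * B) ^ p * ‖P.grad x‖ₑ ^ p) +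
          ENNReal.ofReal (P.weight x) * (ENNReal.ofReal (2 * B) ^ p * ‖P.grad x‖ₑ ^ p) := by gcongr
      _ = D x := by rw [hD]; ring
  refine ⟨hvm.aestronglyMeasurable, hGm.aestronglyMeasurable, fun m : ℕ => P.truncV m,
    fun m => ⟨(P.contDiff_truncV m).contDiffOn, ?_⟩, ?_⟩
  · rw [hen]
    refine ENNReal.rpow_lt_top_of_nonneg (by positivity) (ne_top_of_le_ne_top hDfin ?_)
    refine lintegral_mono_ae ?_
    filter_upwards [ae_axisSq_pos hn] with x hx
    have hg0 : ‖P.grad x‖ ≤ B * ‖P.grad x‖ := le_mul_of_one_le_left (norm_nonneg _) hB1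
    apply hbound
    · have := norm_le_norm_sub_add (gradient (P.truncV m) x) (P.grad x)
      linarith [hdg m x hx.1 hx.2]
    · have := norm_le_norm_sub_add (P.truncV m x) (P.v x)
      have h2 := P.abs_v_le_norm_grad hc x
      rw [← Real.norm_eq_abs] at h2
      linarith [hdv m x hx.1 hx.2]
  · simp only [hen]
    have hlim : Tendsto (fun m : ℕ => ∫⁻ x in Metric.ball 0 1,
        (ENNReal.ofReal (P.weight x) * ‖gradient (P.truncV m) x - P.grad x‖ₑ ^ p +
        ENNReal.ofReal (P.weight x) * ‖P.truncV m x - P.v x‖ₑ ^ p)) atTop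
        (𝓝 (∫⁻ _ in Metric.ball (0 : EuclideanSpace ℝ (Fin (n + 1))) 1, 0)) := by
      refine tendsto_lintegral_of_dominated_convergence D (fun m => ?_) (fun m => ?_) hDfin ?_
      · have h1 := hgm m
        have h2 := hfm m
        fun_prop
      · filter_upwards [ae_axisSq_pos hn] with x hx
        have hg0 : 0 ≤ B * ‖P.grad x‖ := by positivity
        exact hbound _ _ _ (by linarith [hdg m x hx.1 hx.2]) (by linarith [hdv m x hx.1 hx.2])
      · filter_upwards [ae_axisSq_pos hn] with x hx
        apply tendsto_const_nhds.congr'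
        filter_upwards [eventually_ge_atTop ⌈P.φ (axisSq x)⌉₊] with m hm
        have hm' : P.φ (axisSq x) ≤ m := Nat.ceil_le.1 hm
        have e1 : gradient (P.truncV m) x - P.grad x = 0 := by
          rw [gradient_truncV_sub P m hx.2, trunc_of_le hm', truncDeriv_of_le hm', smul_axialVec]
          ext i
          refine Fin.cases ?_ (fun i => ?_) i <;> simp
        have e2 : P.truncV m x - P.v x = 0 := by
          rw [truncV, v, P.truncφ_of_pos m hx.2, trunc_of_le hm', sub_self]
        simp [e1, e2, hp0]
    have := hlim.ennrpow_const (1 / p)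
    simpa [hp0] using this

/-- The function `e ^ (c z) φ (r²)` is a subsolution. -/
theorem isWeakSubsolution (P : Profile n p c) (hn : n ≠ 0) (hp : 1 < p) (hc : 1 ≤ c) :
    IsWeakSubsolution (Metric.ball 0 1) (pLaplaceField P.weight p) p P.v :=
  ⟨P.grad, P.memH hn hp hc, fun _ _ h hpos => P.subsolution_inequality hn hp hc h hpos⟩

end Profile

/-! ### A smooth staircase -/

/-- A smooth staircase on `[0, ∞)`: it climbs by one over each interval `[m, m + 1 / 2]` and is
constant on `[m + 1 / 2, m + 1]`; it vanishes on `(-∞, 0]`. -/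
def stair (τ : ℝ) : ℝ := ⌊τ⌋₊ + Real.smoothTransition (2 * (τ - ⌊τ⌋₊))

/-- The derivative of `stair`. -/
def stairDeriv (τ : ℝ) : ℝ := 2 * deriv Real.smoothTransition (2 * (τ - ⌊τ⌋₊))

lemma stair_eq {m : ℕ} {τ : ℝ} (h1 : m = 0 ∨ (m : ℝ) - 1 / 2 < τ) (h2 : τ < m + 1) :
    stair τ = m + Real.smoothTransition (2 * (τ - m)) := by
  rcases le_or_gt (m : ℝ) τ with h | h
  · have : ⌊τ⌋₊ = m := (Nat.floor_eq_iff (m.cast_nonneg.trans h)).2 ⟨h, h2⟩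
    rw [stair, this]
  · rcases Nat.eq_zero_or_pos m with rfl | hm
    · have : ⌊τ⌋₊ = 0 := Nat.floor_of_nonpos (by simpa using h.le)
      rw [stair, this]
    · have h1' : (m : ℝ) - 1 / 2 < τ := h1.resolve_left hm.ne'
      have hm1 : (1 : ℝ) ≤ m := by exact_mod_cast hm
      have e : ((m - 1 : ℕ) : ℝ) = m - 1 := by push_cast [hm]; ring
      have : ⌊τ⌋₊ = m - 1 := (Nat.floor_eq_iff (by linarith)).2 ⟨by rw [e]; linarith,
        by rw [e]; linarith⟩
      rw [stair, this, e, Real.smoothTransition.one_of_one_le (by linarith),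
        Real.smoothTransition.zero_of_nonpos (by linarith)]
      ring

lemma stair_eventuallyEq (τ : ℝ) :
    stair =ᶠ[𝓝 τ] fun y : ℝ => (⌊τ⌋₊ : ℝ) + Real.smoothTransition (2 * (y - ⌊τ⌋₊)) := by
  have h2 : ∀ᶠ y in 𝓝 τ, y < (⌊τ⌋₊ : ℝ) + 1 := gt_mem_nhds (Nat.lt_floor_add_one τ)
  rcases lt_or_ge τ 0 with h | h
  · have h0 : ⌊τ⌋₊ = 0 := Nat.floor_of_nonpos h.le
    filter_upwards [h2] with y hy2 using stair_eq (Or.inl h0) hy2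
  · have h1 : ∀ᶠ y in 𝓝 τ, (⌊τ⌋₊ : ℝ) - 1 / 2 < y :=
      lt_mem_nhds (by linarith [Nat.floor_le h])
    filter_upwards [h1, h2] with y hy1 hy2 using stair_eq (Or.inr hy1) hy2

lemma contDiff_stair : ContDiff ℝ 1 stair := by
  rw [contDiff_iff_contDiffAt]
  intro τ
  refine ContDiffAt.congr_of_eventuallyEq ?_ (stair_eventuallyEq τ)
  have h : ContDiff ℝ 1 fun y : ℝ => (⌊τ⌋₊ : ℝ) + Real.smoothTransition (2 * (y - ⌊τ⌋₊)) :=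
    contDiff_const.add (Real.smoothTransition.contDiff.comp
      (contDiff_const.mul (contDiff_id.sub contDiff_const)))
  exact h.contDiffAt

lemma hasDerivAt_stair (τ : ℝ) : HasDerivAt stair (stairDeriv τ) τ := by
  refine HasDerivAt.congr_of_eventuallyEq ?_ (stair_eventuallyEq τ)
  have h1 : HasDerivAt (fun y : ℝ => 2 * (y - ⌊τ⌋₊)) (2 * 1) τ :=
    ((hasDerivAt_id τ).sub_const _).const_mul 2
  have h2 := ((hasDerivAt_smoothTransition (2 * (τ - ⌊τ⌋₊))).comp τ h1).const_add (⌊τ⌋₊ : ℝ)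
  convert! h2 using 1
  rw [stairDeriv]; ring

lemma measurable_stair : Measurable stair := contDiff_stair.continuous.measurable

lemma measurable_stairDeriv : Measurable stairDeriv := by
  have : stairDeriv = deriv stair := funext fun τ => (hasDerivAt_stair τ).deriv.symm
  rw [this]; exact measurable_deriv _

lemma stair_nonneg (τ : ℝ) : 0 ≤ stair τ :=
  add_nonneg (Nat.cast_nonneg _) (Real.smoothTransition.nonneg _)

lemma stairDeriv_nonneg (τ : ℝ) : 0 ≤ stairDeriv τ :=
  mul_nonneg zero_le_two (deriv_smoothTransition_nonneg _)

lemma exists_stairDeriv_le : ∃ S, 0 ≤ S ∧ ∀ τ, stairDeriv τ ≤ S := by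
  obtain ⟨S, hS0, hS⟩ := exists_deriv_smoothTransition_le
  refine ⟨2 * S, by positivity, fun τ => ?_⟩
  unfold stairDeriv
  gcongr
  exact (le_abs_self _).trans (hS _)

lemma stair_le {τ : ℝ} (h : 0 ≤ τ) : stair τ ≤ τ + 1 :=
  add_le_add (Nat.floor_le h) (Real.smoothTransition.le_one _)

lemma sub_one_le_stair (τ : ℝ) : τ - 1 ≤ stair τ := by
  have h1 := Nat.lt_floor_add_one τ
  have h2 := Real.smoothTransition.nonneg (2 * (τ - ⌊τ⌋₊))
  unfold stair; linarith

/-- The staircases `stair` and `stair (· + 1 / 2)` climb alternately. -/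
lemma stairDeriv_add_half {τ : ℝ} (h : stairDeriv τ ≠ 0) : stairDeriv (τ + 1 / 2) = 0 := by
  have h0 : 0 < 2 * (τ - ⌊τ⌋₊) := by
    by_contra hle
    exact h (by rw [stairDeriv, deriv_smoothTransition_of_nonpos (not_lt.1 hle), mul_zero])
  have h1 : 2 * (τ - ⌊τ⌋₊) < 1 := by
    by_contra hle
    exact h (by rw [stairDeriv, deriv_smoothTransition_of_one_le (not_lt.1 hle), mul_zero])
  have hτ : 0 ≤ τ := by
    have : (0 : ℝ) ≤ ⌊τ⌋₊ := Nat.cast_nonneg _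
    linarith
  have : ⌊τ + 1 / 2⌋₊ = ⌊τ⌋₊ :=
    (Nat.floor_eq_iff (by linarith)).2 ⟨by linarith, by linarith⟩
  rw [stairDeriv, this, deriv_smoothTransition_of_one_le (by linarith), mul_zero]

/-! ### The logarithmic profile -/

/-- The radial factor of the subsolution: comparable to `log (1 / r)`. -/
def logφ (R : ℝ) : ℝ := (2 + stair (-(Real.log R / 2) + 1 / 2)) * Real.exp (-(R / 2))

/-- The logarithmic slope of `logφ`. -/
def logK (R : ℝ) : ℝ :=
  stairDeriv (-(Real.log R / 2) + 1 / 2) / ((2 + stair (-(Real.log R / 2) + 1 / 2)) * R) + 1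

/-- The radial factor of the flux: comparable to `r ^ (M - n) log (1 / r) ^ b`. -/
def powF (n : ℕ) (M b R : ℝ) : ℝ :=
  R ^ (-(n : ℝ) / 2) * (Real.exp (-(M * stair (-(Real.log R / 2)))) *
    (2 + stair (-(Real.log R / 2))) ^ b)

/-- The radial factor of the divergence of the flux. -/
def powJ (M b R : ℝ) : ℝ :=
  stairDeriv (-(Real.log R / 2)) * (M - b / (2 + stair (-(Real.log R / 2))))

lemma hasDerivAt_neg_half_log {R : ℝ} (hR : 0 < R) :
    HasDerivAt (fun R => -(Real.log R / 2)) (-(1 / (2 * R))) R := by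
  have := ((Real.hasDerivAt_log hR.ne').div_const 2).fun_neg
  convert! this using 1
  field_simp

lemma contDiffAt_logφ {R : ℝ} (hR : 0 < R) : ContDiffAt ℝ 1 logφ R := by
  have h1 : ContDiffAt ℝ 1 (fun R => -(Real.log R / 2) + 1 / 2) R :=
    ((Real.contDiffAt_log.2 hR.ne').div_const 2).neg.add contDiffAt_const
  have h2 : ContDiff ℝ 1 fun R : ℝ => Real.exp (-(R / 2)) := by fun_prop
  exact (contDiffAt_const.add (contDiff_stair.contDiffAt.comp R h1)).mul h2.contDiffAt

lemma hasDerivAt_logφ {R : ℝ} (hR : 0 < R) :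
    HasDerivAt logφ (-(logφ R * logK R) / 2) R := by
  have h2 := ((hasDerivAt_stair (-(Real.log R / 2) + 1 / 2)).comp R
    ((hasDerivAt_neg_half_log hR).add_const (1 / 2))).const_add 2
  have h3 : HasDerivAt (fun R : ℝ => Real.exp (-(R / 2))) (Real.exp (-(R / 2)) * -(1 / 2)) R :=
    (((hasDerivAt_id R).div_const 2).fun_neg).exp
  have h4 := h2.mul h3
  have hpos : 0 < 2 + stair (-(Real.log R / 2) + 1 / 2) := by
    linarith [stair_nonneg (-(Real.log R / 2) + 1 / 2)]
  convert! h4 using 1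
  simp only [logφ, logK, Function.comp_apply]
  generalize 2 + stair (-(Real.log R / 2) + 1 / 2) = A at hpos ⊢
  field_simp
  ring

lemma hasDerivAt_powF (n : ℕ) (M b : ℝ) {R : ℝ} (hR : 0 < R) :
    HasDerivAt (powF n M b) ((powJ M b R - n) * powF n M b R / (2 * R)) R := by
  have h1 := (hasDerivAt_stair (-(Real.log R / 2))).comp R (hasDerivAt_neg_half_log hR)
  have hpos : 0 < 2 + stair (-(Real.log R / 2)) := by
    linarith [stair_nonneg (-(Real.log R / 2))]
  have h2 := ((h1.const_mul M).fun_neg).exp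
  have h3 := (h1.const_add 2).rpow_const (p := b) (Or.inl hpos.ne')
  have h4 := Real.hasDerivAt_rpow_const (x := R) (p := -(n : ℝ) / 2) (Or.inl hR.ne')
  have h5 := h4.mul (h2.mul h3)
  convert! h5 using 1
  simp only [powF, powJ, Function.comp_apply, Real.rpow_sub_one hR.ne', Pi.mul_apply,
    Real.rpow_sub_one hpos.ne']
  field_simp
  ring

section Bounds

variable {R : ℝ}

lemma logScale_bounds (h0 : 0 < R) (h1 : R < 1) :
    (logScale R / 2 ≤ 2 + stair (-(Real.log R / 2) + 1 / 2) ∧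
      2 + stair (-(Real.log R / 2) + 1 / 2) ≤ 2 * logScale R) ∧
    (logScale R / 2 ≤ 2 + stair (-(Real.log R / 2)) ∧
      2 + stair (-(Real.log R / 2)) ≤ 2 * logScale R) := by
  have hl := Real.log_nonpos h0.le h1.le
  have a1 := sub_one_le_stair (-(Real.log R / 2) + 1 / 2)
  have a2 := stair_le (τ := -(Real.log R / 2) + 1 / 2) (by linarith)
  have a3 := sub_one_le_stair (-(Real.log R / 2))
  have a4 := stair_le (τ := -(Real.log R / 2)) (by linarith)
  unfold logScale
  refine ⟨⟨?_, ?_⟩, ?_, ?_⟩ <;> linarith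

lemma logφ_bounds (h0 : 0 < R) (h1 : R < 1) :
    logScale R / 4 ≤ logφ R ∧ logφ R ≤ 2 * logScale R := by
  obtain ⟨⟨a1, a2⟩, -⟩ := logScale_bounds h0 h1
  have hl := two_le_logScale h0.le h1.le
  have e1 : Real.exp (-(R / 2)) ≤ 1 := Real.exp_le_one_iff.2 (by linarith)
  have e2 : 1 / 2 ≤ Real.exp (-(R / 2)) := by linarith [Real.add_one_le_exp (-(R / 2))]
  unfold logφ
  constructor <;> nlinarith

lemma one_le_logφ (h0 : 0 < R) (h1 : R < 1) : 1 ≤ logφ R := by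
  have a1 := stair_nonneg (-(Real.log R / 2) + 1 / 2)
  have e2 : 1 / 2 ≤ Real.exp (-(R / 2)) := by linarith [Real.add_one_le_exp (-(R / 2))]
  unfold logφ
  nlinarith

lemma one_le_logK (h0 : 0 < R) : 1 ≤ logK R := by
  have := stairDeriv_nonneg (-(Real.log R / 2) + 1 / 2)
  have := stair_nonneg (-(Real.log R / 2) + 1 / 2)
  unfold logK
  have : 0 ≤ stairDeriv (-(Real.log R / 2) + 1 / 2) /
    ((2 + stair (-(Real.log R / 2) + 1 / 2)) * R) := by positivity
  linarith

lemma logScale_mul_le (h0 : 0 < R) (h1 : R < 1) :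
    logScale R * R ≤ 3 ∧ logScale R ^ 2 * R ≤ 9 := by
  have hl := two_le_logScale h0.le h1.le
  have aux : ∀ y : ℝ, 0 < y → y < 1 → -(y * Real.log y) ≤ 1 := by
    intro y hy hy1
    have := Real.one_sub_inv_le_log_of_pos hy
    have h := mul_le_mul_of_nonneg_left this hy.le
    rw [mul_sub, mul_inv_cancel₀ hy.ne'] at h
    linarith
  constructor
  · have := aux R h0 h1
    unfold logScale; nlinarith
  · have hs0 : 0 < √R := Real.sqrt_pos.2 h0
    have hs1 : √R < 1 := by rw [Real.sqrt_lt' one_pos]; simpa using h1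
    have := aux _ hs0 hs1
    rw [Real.log_sqrt h0.le] at this
    have h3 : logScale R * √R ≤ 3 := by unfold logScale; nlinarith
    have h4 : 0 ≤ logScale R * √R := by positivity
    calc logScale R ^ 2 * R = (logScale R * √R) ^ 2 := by rw [mul_pow, Real.sq_sqrt h0.le]
      _ ≤ 3 ^ 2 := by gcongr
      _ = 9 := by norm_num

lemma logK_le {S : ℝ} (hS0 : 0 ≤ S) (hS : ∀ τ, stairDeriv τ ≤ S) (h0 : 0 < R) (h1 : R < 1) :
    logK R ≤ (2 * S + 3) / (logScale R * R) := by
  have hl := two_le_logScale h0.le h1.le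
  obtain ⟨⟨a1, -⟩, -⟩ := logScale_bounds h0 h1
  rw [logK, add_div]
  have hpos : 0 < logScale R * R := by positivity
  refine add_le_add ?_ ?_
  · have : stairDeriv (-(Real.log R / 2) + 1 / 2) / ((2 + stair (-(Real.log R / 2) + 1 / 2)) * R) ≤
        S / (logScale R / 2 * R) := by
      gcongr
      exact hS _
    refine this.trans_eq ?_
    field_simp
  · rw [le_div_iff₀ hpos]; linarith [logScale_mul_le h0 h1]

lemma powF_pos (n : ℕ) (M b : ℝ) (h0 : 0 < R) : 0 < powF n M b R := by
  have := stair_nonneg (-(Real.log R / 2))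
  unfold powF; positivity

lemma powF_bounds (n : ℕ) {M b : ℝ} (hM : 0 ≤ M) (hb : 0 ≤ b) (h0 : 0 < R) (h1 : R < 1) :
    powF n M b R ≤ (Real.exp M * 2 ^ b) * (R ^ ((M - n) / 2) * logScale R ^ b) ∧
    R ^ ((M - n) / 2) * logScale R ^ b ≤ (Real.exp M * 2 ^ b) * powF n M b R := by
  have hl := two_le_logScale h0.le h1.le
  have hlog := Real.log_nonpos h0.le h1.le
  obtain ⟨-, a1, a2⟩ := logScale_bounds h0 h1
  have a3 := sub_one_le_stair (-(Real.log R / 2))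
  have a4 := stair_le (τ := -(Real.log R / 2)) (by linarith)
  have a5 := stair_nonneg (-(Real.log R / 2))
  have e : R ^ ((M - n) / 2) = R ^ (-(n : ℝ) / 2) * Real.exp (M * (Real.log R / 2)) := by
    rw [Real.rpow_def_of_pos h0, Real.rpow_def_of_pos h0, ← Real.exp_add]
    congr 1; ring
  have hRn : 0 < R ^ (-(n : ℝ) / 2) := by positivity
  rw [e, powF]
  constructor
  · have b1 : Real.exp (-(M * stair (-(Real.log R / 2)))) ≤
        Real.exp M * Real.exp (M * (Real.log R / 2)) := by
      rw [← Real.exp_add]; apply Real.exp_le_exp.2; nlinarith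
    have b2 : (2 + stair (-(Real.log R / 2))) ^ b ≤ 2 ^ b * logScale R ^ b := by
      rw [← Real.mul_rpow (by norm_num) (by linarith)]
      exact Real.rpow_le_rpow (by linarith) a2 hb
    calc _ ≤ R ^ (-(n : ℝ) / 2) * (Real.exp M * Real.exp (M * (Real.log R / 2)) *
          (2 ^ b * logScale R ^ b)) := by gcongr
      _ = _ := by ring
  · have b1 : Real.exp (M * (Real.log R / 2)) ≤
        Real.exp M * Real.exp (-(M * stair (-(Real.log R / 2)))) := by
      rw [← Real.exp_add]; apply Real.exp_le_exp.2; nlinarith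
    have b2 : logScale R ^ b ≤ 2 ^ b * (2 + stair (-(Real.log R / 2))) ^ b := by
      rw [← Real.mul_rpow (by norm_num) (by linarith)]
      exact Real.rpow_le_rpow (by linarith) (by linarith) hb
    calc _ ≤ R ^ (-(n : ℝ) / 2) * (Real.exp M * Real.exp (-(M * stair (-(Real.log R / 2))))) *
          (2 ^ b * (2 + stair (-(Real.log R / 2))) ^ b) := by gcongr
      _ = _ := by ring

end Bounds

lemma tendsto_logφ : Tendsto logφ (𝓝[>] 0) atTop := by
  have h1 : Tendsto (fun R => logScale R / 4) (𝓝[>] 0) atTop := by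
    have h2 := (tendsto_neg_atBot_atTop.comp Real.tendsto_log_nhdsGT_zero).atTop_div_const
      (show (0 : ℝ) < 2 by norm_num)
    have h3 := (tendsto_atTop_add_const_left _ 2 h2).atTop_div_const (show (0 : ℝ) < 4 by norm_num)
    refine h3.congr fun R => ?_
    simp only [logScale, Function.comp_apply]; ring
  refine tendsto_atTop_mono' _ ?_ h1
  filter_upwards [Ioo_mem_nhdsGT one_pos] with R hR using (logφ_bounds hR.1 hR.2).1

lemma measurable_logφ : Measurable logφ := by
  have := measurable_stair
  unfold logφ; fun_prop

lemma measurable_logK : Measurable logK := by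
  have := measurable_stair
  have := measurable_stairDeriv
  unfold logK; fun_prop

lemma measurable_powF (n : ℕ) (M b : ℝ) : Measurable (powF n M b) := by
  have := measurable_stair
  unfold powF; fun_prop

lemma measurable_powJ (M b : ℝ) : Measurable (powJ M b) := by
  have := measurable_stair
  have := measurable_stairDeriv
  unfold powJ; fun_prop

/-- The logarithmic profile satisfies the subsolution property for large `c`: the flux varies only
where `logφ` is flat. -/
lemma exists_profile {n : ℕ} (hn : n ≠ 0) {p M b : ℝ} (hp : 1 < p) (hM : 0 < M) (hb : 0 ≤ b) :
    ∃ c, 1 ≤ c ∧ ∃ P : Profile n p c, P.φ = logφ ∧ P.k = logK ∧ P.f = powF n M b := by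
  obtain ⟨S, hS0, hS⟩ := exists_stairDeriv_le
  have hp1 : 0 < p - 1 := by linarith
  set c := 1 + S * M / (p - 1) with hc
  have hc1 : 1 ≤ c := by
    have : 0 ≤ S * M / (p - 1) := by positivity
    linarith
  have hcS : S * M ≤ (p - 1) * c ^ 2 := by
    have h1 : S * M / (p - 1) ≤ c ^ 2 := by nlinarith
    rw [div_le_iff₀ hp1] at h1
    linarith
  have hflat : ∀ R, powJ M b R = 0 ∨ logK R = 1 := by
    intro R
    by_cases h : stairDeriv (-(Real.log R / 2)) = 0
    · left; rw [powJ, h, zero_mul]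
    · right; rw [logK, stairDeriv_add_half h, zero_div, zero_add]
  have hfrac : ∀ R, 0 ≤ b / (2 + stair (-(Real.log R / 2))) ∧
      b / (2 + stair (-(Real.log R / 2))) ≤ b := by
    intro R
    have := stair_nonneg (-(Real.log R / 2))
    exact ⟨by positivity, div_le_self hb (by linarith)⟩
  have hj : ∀ R, powJ M b R ≤ S * M := by
    intro R
    have h1 := hS (-(Real.log R / 2))
    have h2 := stairDeriv_nonneg (-(Real.log R / 2))
    calc powJ M b R ≤ stairDeriv (-(Real.log R / 2)) * M := by
          unfold powJ; gcongr; linarith [hfrac R]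
      _ ≤ _ := by gcongr
  have hj' : ∀ R, |powJ M b R| ≤ S * (M + b) := by
    intro R
    have h1 := hS (-(Real.log R / 2))
    have h2 := stairDeriv_nonneg (-(Real.log R / 2))
    rw [powJ, abs_mul, abs_of_nonneg h2]
    have h3 : |M - b / (2 + stair (-(Real.log R / 2)))| ≤ M + b := by
      rw [abs_le]; constructor <;> linarith [hfrac R]
    gcongr
  refine ⟨c, hc1, ⟨logφ, logK, powF n M b, powJ M b, S * (M + b) + (2 * S + 3), measurable_logφ,
    measurable_logK, measurable_powF n M b, measurable_powJ M b, fun R => contDiffAt_logφ,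
    fun R => hasDerivAt_logφ, fun R h0 _ => hasDerivAt_powF n M b h0, fun R => one_le_logφ,
    fun R => one_le_logK, fun R => powF_pos n M b, fun R h0 h1 => ?_, fun R _ _ => ?_,
    fun R _ _ => ?_, tendsto_logφ, ?_⟩, rfl, rfl, rfl⟩
  · have hl := two_le_logScale h0.le h1.le
    have h2 := logK_le hS0 hS h0 h1
    rw [le_div_iff₀ (by positivity)] at h2
    have h3 := one_le_logK h0
    have h4 : 0 ≤ S * (M + b) := by positivity
    have h5 : logK R * R ≤ logK R * (logScale R * R) := by
      gcongr
      exact le_mul_of_one_le_left h0.le (by linarith)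
    linarith
  · rcases hflat R with h | h
    · rw [h, zero_mul]; positivity
    · rw [h, mul_one]; exact (hj R).trans hcS
  · have h4 : 0 ≤ S * (M + b) := by positivity
    rcases hflat R with h | h
    · rw [h, abs_zero, zero_mul]; positivity
    · rw [h, mul_one]; linarith [hj' R]
  · have hm : Measurable fun x : EuclideanSpace ℝ (Fin (n + 1)) =>
        logφ (axisSq x) * powF n M b (axisSq x) :=
      (measurable_logφ.comp measurable_axisSq).mul
        ((measurable_powF n M b).comp measurable_axisSq)
    have := memLp_of_le_critical (s := 1) (α := n - M) (β := -(b + 1))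
      (C := 2 * (Real.exp M * 2 ^ b)) hn one_ne_zero hm.aestronglyMeasurable ?_
      (Or.inl (by simpa using hM))
    · exact memLp_one_iff_integrable.1 this
    · intro x hx h0
      have h1 := axisSq_lt_one hx
      have hl := two_le_logScale h0.le h1.le
      have a1 := (logφ_bounds h0 h1).2
      have a2 := (powF_bounds n hM.le hb h0 h1).1
      have a3 := one_le_logφ h0 h1
      have a4 := powF_pos n M b h0
      rw [abs_of_nonneg (by positivity), neg_neg, neg_sub, Real.rpow_add (by linarith),
        Real.rpow_one]
      calc _ ≤ 2 * logScale (axisSq x) * ((Real.exp M * 2 ^ b) *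
            (axisSq x ^ ((M - n) / 2) * logScale (axisSq x) ^ b)) := by gcongr
        _ = _ := by ring

/-! ### Integrability of the weight and of its inverse -/

namespace Profile

lemma exists_le_k_mul (P : Profile n p c) (hp : 1 < p) (hc : 1 ≤ c) : ∃ κ, 0 < κ ∧
    ∀ R, 0 < R → R < 1 → κ ≤ P.k R * (c ^ 2 + P.k R ^ 2 * R) ^ ((p - 2) / 2) := by
  rcases le_total 2 p with h | h
  · refine ⟨1, one_pos, fun R h0 _ => ?_⟩
    have h1 : 1 ≤ c ^ 2 + P.k R ^ 2 * R := by
      have : 0 ≤ P.k R ^ 2 * R := by positivity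
      nlinarith
    exact one_le_mul_of_one_le_of_one_le (P.one_le_k R h0)
      (Real.one_le_rpow h1 (by linarith))
  · refine ⟨(c ^ 2 + 1) ^ ((p - 2) / 2), by positivity, fun R h0 h1 => ?_⟩
    have hk := P.one_le_k R h0
    have hk0 := P.k_pos h0
    have hy : c ^ 2 + P.k R ^ 2 * R ≤ P.k R ^ 2 * (c ^ 2 + 1) := by
      have h2 : c ^ 2 ≤ P.k R ^ 2 * c ^ 2 :=
        le_mul_of_one_le_left (by positivity) (one_le_pow₀ hk)
      have h3 : P.k R ^ 2 * R ≤ P.k R ^ 2 := mul_le_of_le_one_right (by positivity) h1.le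
      linarith
    calc (c ^ 2 + 1) ^ ((p - 2) / 2) ≤ P.k R ^ (p - 1) * (c ^ 2 + 1) ^ ((p - 2) / 2) :=
          le_mul_of_one_le_left (by positivity) (Real.one_le_rpow hk (by linarith))
      _ = P.k R * (P.k R ^ 2 * (c ^ 2 + 1)) ^ ((p - 2) / 2) := by
          rw [Real.mul_rpow (by positivity) (by positivity), ← Real.rpow_natCast (P.k R) 2,
            ← Real.rpow_mul hk0.le, ← mul_assoc]
          congr 1
          rw [← Real.rpow_one_add' hk0.le (by push_cast; linarith)]
          congr 1; push_cast; ring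
      _ ≤ _ := by
          gcongr P.k R * ?_
          exact Real.rpow_le_rpow_of_nonpos (by positivity) hy (by linarith)

end Profile

/-- The weight of the logarithmic profile and its inverse have, up to logarithms, the size of
powers of `r` with exponents summing to `-p`. -/
lemma exists_profile_weight_le {n : ℕ} (hn : n ≠ 0) {p M b : ℝ} (hp : 1 < p) (hM : 0 < M)
    (hb : 0 ≤ b) :
    ∃ c, 1 ≤ c ∧ ∃ (P : Profile n p c) (C : ℝ), ∀ x ∈ Metric.ball 0 1, 0 < axisSq x →
      P.weight x ≤ C * (axisSq x ^ (-(n - M) / 2) * logScale (axisSq x) ^ (-(p - 1 - b))) ∧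
      (P.weight x)⁻¹ ≤ C * (axisSq x ^ (-(M - n + p) / 2) * logScale (axisSq x) ^ (-b)) := by
  obtain ⟨c, hc, P, hφ, hk, hf⟩ := exists_profile hn hp hM hb
  obtain ⟨S, hS0, hS⟩ := exists_stairDeriv_le
  obtain ⟨κ, hκ0, hκ⟩ := P.exists_le_k_mul hp hc
  have hp1 : 0 < p - 1 := by linarith
  set A := Real.exp M * 2 ^ b with hA
  have hA0 : 0 < A := by positivity
  set D := 9 * c ^ 2 + (2 * S + 3) ^ 2 with hD
  have hD0 : 0 < D := by positivity
  refine ⟨c, hc, P, max (A * 4 ^ (p - 1) / κ) (A * 2 ^ (p - 1) * D ^ ((p - 1) / 2)),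
    fun x hx h0 => ?_⟩
  have h1 := axisSq_lt_one hx
  rw [Profile.weight, if_neg h0.ne', mul_right_comm]
  set R := axisSq x
  have hl := two_le_logScale h0.le h1.le
  have hl0 : 0 < logScale R := by linarith
  obtain ⟨φ1, φ2⟩ := logφ_bounds h0 h1
  obtain ⟨f1, f2⟩ := powF_bounds n hM.le hb h0 h1
  have hκR := hκ R h0 h1
  have hφ0 : 0 < P.φ R := P.φ_pos h0 h1
  have hf0 : 0 < P.f R := P.f_pos R h0
  have hk0 : 0 < P.k R := P.k_pos h0
  rw [← hφ] at φ1 φ2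
  rw [← hf] at f1 f2
  set y := c ^ 2 + P.k R ^ 2 * R with hy
  have hy0 : 0 < y := by positivity
  constructor
  · have e1 : (logScale R / 4) ^ (p - 1) ≤ P.φ R ^ (p - 1) :=
      Real.rpow_le_rpow (by positivity) φ1 hp1.le
    calc P.f R / (P.k R * y ^ ((p - 2) / 2) * P.φ R ^ (p - 1)) ≤
          A * (R ^ ((M - n) / 2) * logScale R ^ b) / (κ * (logScale R / 4) ^ (p - 1)) := by gcongr
      _ = A * 4 ^ (p - 1) / κ * (R ^ (-(n - M) / 2) * logScale R ^ (-(p - 1 - b))) := by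
          rw [Real.div_rpow hl0.le (by norm_num), neg_sub, neg_sub,
            Real.rpow_sub hl0 b (p - 1)]
          field_simp
      _ ≤ _ := by gcongr; exact le_max_left _ _
  · -- `k √R ≤ √y ≤ C / (ℓ √R)`, where `ℓ` is the logarithmic scale
    have hkle := logK_le hS0 hS h0 h1
    rw [← hk] at hkle
    obtain ⟨-, hlR⟩ := logScale_mul_le h0 h1
    have y1 : y ≤ D * (logScale R ^ 2 * R)⁻¹ := by
      rw [hy, hD, add_mul]
      refine add_le_add ?_ ?_
      · rw [← div_eq_mul_inv, le_div_iff₀ (by positivity)]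
        nlinarith [sq_nonneg c]
      · calc P.k R ^ 2 * R ≤ ((2 * S + 3) / (logScale R * R)) ^ 2 * R := by gcongr
          _ = _ := by field_simp
    have y2 : P.k R * y ^ ((p - 2) / 2) ≤ y ^ ((p - 1) / 2) * R ^ (-(1 / 2) : ℝ) := by
      have hsq : P.k R ≤ y ^ (1 / 2 : ℝ) * R ^ (-(1 / 2) : ℝ) := by
        rw [← Real.sqrt_eq_rpow, Real.rpow_neg h0.le, ← Real.sqrt_eq_rpow, ← div_eq_mul_inv,
          ← Real.sqrt_div hy0.le]
        apply Real.le_sqrt_of_sq_le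
        rw [le_div_iff₀ h0]
        nlinarith [sq_nonneg c]
      calc _ ≤ y ^ (1 / 2 : ℝ) * R ^ (-(1 / 2) : ℝ) * y ^ ((p - 2) / 2) := by gcongr
        _ = y ^ (1 / 2 : ℝ) * y ^ ((p - 2) / 2) * R ^ (-(1 / 2) : ℝ) := by ring
        _ = _ := by rw [← Real.rpow_add hy0]; congr 2; ring
    have y3 : y ^ ((p - 1) / 2) ≤ D ^ ((p - 1) / 2) * (logScale R ^ (-(p - 1)) *
        R ^ (-((p - 1) / 2))) := by
      calc _ ≤ (D * (logScale R ^ 2 * R)⁻¹) ^ ((p - 1) / 2) := by gcongr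
        _ = _ := by
          rw [Real.mul_rpow hD0.le (by positivity), Real.inv_rpow (by positivity),
            Real.mul_rpow (by positivity) h0.le, mul_inv, ← Real.rpow_natCast (logScale R) 2,
            ← Real.rpow_mul hl0.le, ← Real.rpow_neg hl0.le, ← Real.rpow_neg h0.le]
          congr 4; push_cast; ring
    have e1 : P.φ R ^ (p - 1) ≤ (2 * logScale R) ^ (p - 1) :=
      Real.rpow_le_rpow hφ0.le φ2 hp1.le
    have f3 : (P.f R)⁻¹ ≤ A * (R ^ ((M - n) / 2) * logScale R ^ b)⁻¹ := by
      rw [← div_eq_mul_inv, le_div_iff₀ (by positivity), inv_mul_le_iff₀ hf0]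
      linarith
    calc (P.f R / (P.k R * y ^ ((p - 2) / 2) * P.φ R ^ (p - 1)))⁻¹
        = (P.k R * y ^ ((p - 2) / 2)) * P.φ R ^ (p - 1) * (P.f R)⁻¹ := by
          rw [inv_div, div_eq_mul_inv]
      _ ≤ (D ^ ((p - 1) / 2) * (logScale R ^ (-(p - 1)) * R ^ (-((p - 1) / 2))) *
            R ^ (-(1 / 2) : ℝ)) * (2 * logScale R) ^ (p - 1) *
            (A * (R ^ ((M - n) / 2) * logScale R ^ b)⁻¹) := by
          have y4 := y2.trans (mul_le_mul_of_nonneg_right y3 (by positivity))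
          exact mul_le_mul (mul_le_mul y4 e1 (by positivity) (by positivity)) f3 (by positivity)
            (by positivity)
      _ = A * 2 ^ (p - 1) * D ^ ((p - 1) / 2) * ((logScale R ^ (-(p - 1)) *
            logScale R ^ (p - 1) * logScale R ^ (-b)) *
            (R ^ (-((p - 1) / 2)) * R ^ (-(1 / 2) : ℝ) * R ^ (-((M - n) / 2)))) := by
          rw [Real.mul_rpow (by norm_num) hl0.le, Real.rpow_neg hl0.le b,
            Real.rpow_neg h0.le ((M - n) / 2), mul_inv]
          ring
      _ = A * 2 ^ (p - 1) * D ^ ((p - 1) / 2) *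
            (R ^ (-(M - n + p) / 2) * logScale R ^ (-b)) := by
          rw [← Real.rpow_add hl0, ← Real.rpow_add hl0, ← Real.rpow_add h0, ← Real.rpow_add h0,
            mul_comm (logScale R ^ _)]
          congr 3 <;> ring
      _ ≤ _ := by gcongr; exact le_max_right _ _

/-- Existence of unbounded subsolutions, in terms of the exponent `M` and the logarithmic
correction `b`. -/
lemma exists_unbounded_subsolution {n : ℕ} (hn : n ≠ 0) {p M b : ℝ} (hp : 1 < p) (hM : 0 < M)
    (hb : 0 ≤ b) {s t : ℝ≥0∞} (hs : s ≠ 0) (ht : t ≠ 0)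
    (hsM : n - M < n * (1 / s).toReal ∨ n - M = n * (1 / s).toReal ∧ (1 / s).toReal < p - 1 - b)
    (htM : M - n + p < n * (1 / t).toReal ∨
      M - n + p = n * (1 / t).toReal ∧ (1 / t).toReal < b) :
    ∃ w : EuclideanSpace ℝ (Fin (n + 1)) → ℝ,
      (∀ x ∈ Metric.ball (0 : EuclideanSpace ℝ (Fin (n + 1))) 1, 0 < w x) ∧
      MemLp w s (volume.restrict (Metric.ball 0 1)) ∧
      MemLp (fun x => (w x)⁻¹) t (volume.restrict (Metric.ball 0 1)) ∧
      ∃ v : EuclideanSpace ℝ (Fin (n + 1)) → ℝ,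
        IsWeakSubsolution (Metric.ball 0 1) (pLaplaceField w p) p v ∧
        ¬ LocallyBoundedAbove (Metric.ball 0 1) v := by
  obtain ⟨c, hc, P, C, hC⟩ := exists_profile_weight_le hn hp hM hb
  refine ⟨P.weight, fun x hx => P.weight_pos hx, ?_, ?_, P.v, P.isWeakSubsolution hn hp hc,
    P.not_locallyBoundedAbove hn⟩
  · refine memLp_of_le_critical (C := C) hn hs P.measurable_weight.aestronglyMeasurable
      (fun x hx h0 => ?_) hsM
    rw [abs_of_pos (P.weight_pos hx)]
    exact (hC x hx h0).1
  · refine memLp_of_le_critical (C := C) hn ht P.measurable_weight.inv.aestronglyMeasurable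
      (fun x hx h0 => ?_) htM
    rw [abs_of_pos (inv_pos.2 (P.weight_pos hx))]
    exact (hC x hx h0).2

end DegenerateElliptic

end

theorem theorem2 (d : ℕ) (hd : 3 ≤ d) (p : ℝ) (s t : ℝ≥0∞)
    (hs : 1 ≤ s) (ht : ENNReal.ofReal (1 / (p - 1)) < t)
    (hpst :
      (1 + 1 / ((d : ℝ) - 2) < p ∧
        ENNReal.ofReal (p / ((d : ℝ) - 1)) ≤ 1 / s + 1 / t ∧
        ENNReal.ofReal p / (1 + 1 / t) < ENNReal.ofReal ((d : ℝ) - 1)) ∨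
      (1 < p ∧ p ≤ 1 + 1 / ((d : ℝ) - 2) ∧
        ENNReal.ofReal (p / ((d : ℝ) - 1)) < 1 / s + 1 / t ∧
        ENNReal.ofReal p / (1 + 1 / t) < ENNReal.ofReal ((d : ℝ) - 1))) :
    ∃ w : EuclideanSpace ℝ (Fin d) → ℝ,
      (∀ x ∈ Metric.ball (0 : EuclideanSpace ℝ (Fin d)) 1, 0 < w x) ∧
      MemLp w s (volume.restrict (Metric.ball 0 1)) ∧
      MemLp (fun x => (w x)⁻¹) t (volume.restrict (Metric.ball 0 1)) ∧
      ∃ v : EuclideanSpace ℝ (Fin d) → ℝ,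
        DegenerateElliptic.IsWeakSubsolution (Metric.ball 0 1)
          (DegenerateElliptic.pLaplaceField w p) p v ∧
        ¬ DegenerateElliptic.LocallyBoundedAbove (Metric.ball 0 1) v := by
  obtain ⟨n, rfl⟩ : ∃ n, d = n + 1 := ⟨d - 1, by omega⟩
  have hn2 : 2 ≤ n := by omega
  have hn : n ≠ 0 := by omega
  have hnR : (2 : ℝ) ≤ n := by exact_mod_cast hn2
  have hn0 : (0 : ℝ) < n := by linarith
  have hs0 : s ≠ 0 := (one_pos.trans_le hs).ne'
  have ht0 : t ≠ 0 := (zero_le.trans_lt ht).ne'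
  have hsfin : 1 / s ≠ ∞ := by simpa using hs0
  have htfin : 1 / t ≠ ∞ := by simpa using ht0
  set σ := (1 / s).toReal with hσ
  set τ := (1 / t).toReal with hτ
  have hσ0 : 0 ≤ σ := ENNReal.toReal_nonneg
  have hτ0 : 0 ≤ τ := ENNReal.toReal_nonneg
  have hσ1 : σ ≤ 1 := by
    rw [hσ, ← ENNReal.toReal_one]
    refine ENNReal.toReal_mono ENNReal.one_ne_top ?_
    rw [one_div]
    exact ENNReal.inv_le_one.2 hs
  have e1 : (1 / s + 1 / t) = ENNReal.ofReal (σ + τ) := by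
    rw [ENNReal.ofReal_add hσ0 hτ0, hσ, hτ, ENNReal.ofReal_toReal hsfin,
      ENNReal.ofReal_toReal htfin]
  have e2 : (1 + 1 / t) = ENNReal.ofReal (1 + τ) := by
    rw [ENNReal.ofReal_add zero_le_one hτ0, hτ, ENNReal.ofReal_one, ENNReal.ofReal_toReal htfin]
  have ed : ((n + 1 : ℕ) : ℝ) - 1 = n := by push_cast; ring
  have ed2 : ((n + 1 : ℕ) : ℝ) - 2 = n - 1 := by push_cast; ring
  rw [e1, e2, ed, ed2, ENNReal.ofReal_le_ofReal_iff (by positivity),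
    ← ENNReal.ofReal_div_of_pos (by positivity), ENNReal.ofReal_lt_ofReal_iff hn0,
    ENNReal.ofReal_lt_ofReal_iff', div_le_iff₀ hn0, div_lt_iff₀ hn0,
    div_lt_iff₀ (by positivity)] at hpst
  have hp : 1 < p := by
    rcases hpst with h | h
    · have : 0 < 1 / ((n : ℝ) - 1) := one_div_pos.2 (by linarith)
      linarith [h.1]
    · exact h.1
  by_cases hlt : p < (σ + τ) * n
  · -- the subcritical case: a pure power
    have hp3 : p < n * (1 + τ) := by
      rcases hpst with h | h
      · exact h.2.2
      · exact h.2.2.2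
    obtain ⟨M, hM1, hM2⟩ : ∃ M, n - n * σ < M ∧ M < n - p + n * τ :=
      exists_between (by linarith)
    have hM0 : 0 < M := by nlinarith
    exact DegenerateElliptic.exists_unbounded_subsolution hn hp hM0 le_rfl hs0 ht0
      (Or.inl (by linarith)) (Or.inl (by linarith))
  · -- the critical case: logarithmic corrections
    obtain ⟨h1, h2, h3⟩ := hpst.resolve_right fun h => hlt h.2.2.1.1
    have heq : p = (σ + τ) * n := le_antisymm h2 (not_lt.1 hlt)
    have hστ : σ + τ < p - 1 := by
      have h4 : 0 < (n : ℝ) - 1 := by linarith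
      have h5 : 1 < (p - 1) * (n - 1) := by
        rw [← div_lt_iff₀ h4]; linarith
      have : (σ + τ) * n < (p - 1) * n := by rw [← heq]; linarith
      exact lt_of_mul_lt_mul_right this hn0.le
    obtain ⟨b, hb1, hb2⟩ : ∃ b, τ < b ∧ b < p - 1 - σ := exists_between (by linarith)
    have hM0 : 0 < n - n * σ := by nlinarith
    exact DegenerateElliptic.exists_unbounded_subsolution hn hp hM0 (hτ0.trans hb1.le) hs0 ht0
      (Or.inr ⟨by ring, by linarith⟩) (Or.inr ⟨by rw [heq]; ring, hb1⟩)
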